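/- Throughout, $[n]=\{1,\dots,n\}$ and $\log$ is to base $2$. A hypergraph is identified with its set of edges; an $m$-graph on $[n]$ is a set of $m$-element subsets of $[n]$. For $k\ge 3$, a (loose) cycle $C_k$ is a hypergraph with distinct edges $e_1,\dots,e_k$ and distinct vertices $v_1,\dots,v_k$ such that $e_i\cap e_{i+1}=\{v_i\}$ for $1\le i\le k-1$, $e_1\cap e_k=\{v_k\}$, and $e_i\cap e_j=\emptyset$ for all other pairs $i\ne j$. An edge-colored $(r-1)$-graph on $[n]$ is an $(r-1)$-graph $G$ on $[n]$ together with a color $z_e\in[n]\setminus e$ for each $e\in G$; its extension is the $r$-graph $G^*=\{e\cup\{z_e\}:e\in G\}$. For $r,k\ge 3$ let $g_r(n,k)$ be the number of edge-colored $(r-1)$-graphs on $[n]$ whose extension $G^*$ contains no $C_k$ as a (not necessarily induced) subgraph. **Lemma.** There are positive real constants $c_1=c_1(r)$ depending only on $r$, $c_2=c_2(r,k)$ depending only on $r$ and $k$, and $D_\ell$ depending only on $\ell$, such that for all integers $r\ge 3$ and $k\ge 3$ there is $n_0=n_0(r,k)$ for which every $n\ge n_0$ satisfies, with $D=D_{k/2}$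 in the first case, $$g_r(n,k)\le\begin{cases}2^{(3kc_1+4\log D)\,n^2}&\text{if } r=3 \text{ and } k \text{ is even},\\[2pt] 2^{2(c_2+2r)\,c_1\,n^{r-1}(\log n)^{(r-3)/(r-2)}}&\text{if } r>3.\end{cases}$$ In particular, for fixed $r$ and $k$, in both cases $g_r(n,k)=2^{O\left(n^{r-1}(\log n)^{(r-3)/(r-2)}\right)}$ as $n\to\infty$. -/

import Mathlib

open Filter Asymptotics

namespace LooseCycles

/-- The edges `e i` and vertices `v i`, with `i` running over `Fin k`, form a loose (linear) cycle
of length `k`: the edges are distinct, the vertices are distinct, cyclically consecutive edges meet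
exactly in the vertex `v i`, and all other pairs of edges are disjoint. Here `finRotate k i` is the
cyclic successor of `i`. The notion is used for `3 ≤ k`. -/
structure IsLooseCycle {V : Type*} [DecidableEq V] (k : ℕ) (e : Fin k → Finset V) (v : Fin k → V) :
    Prop where
  edge_injective : Function.Injective e
  vertex_injective : Function.Injective v
  inter_next : ∀ i, e i ∩ e (finRotate k i) = {v i}
  disjoint_other : ∀ i j, i ≠ j → j ≠ finRotate k i → i ≠ finRotate k j → Disjoint (e i) (e j)

/-- The hypergraph with edge set `H` contains no loose cycle of length `k` as a (not necessarily
induced) subgraph. -/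
def LooseCycleFree {V : Type*} [DecidableEq V] (k : ℕ) (H : Finset (Finset V)) : Prop :=
  ¬ ∃ (e : Fin k → Finset V) (v : Fin k → V), (∀ i, e i ∈ H) ∧ IsLooseCycle k e v

/-- An edge-colored `m`-graph with vertices in `V`: a set of `m`-element subsets of `V`, and for
each edge `e` a color, which is an element of `V` outside `e`. -/
structure EdgeColoredGraph (m : ℕ) (V : Type*) where
  edges : Finset (Finset V)
  sized : (edges : Set (Finset V)).Sized m
  color : edges → V
  color_notMem : ∀ e : edges, color e ∉ (e : Finset V)

/-- The extension of an edge-colored `m`-graph: the `(m + 1)`-graph whose edges are the sets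
`e ∪ {color of e}`. -/
def EdgeColoredGraph.extension {m : ℕ} {V : Type*} [DecidableEq V] (G : EdgeColoredGraph m V) :
    Finset (Finset V) :=
  G.edges.attach.image fun e => insert (G.color e) (e : Finset V)

/-- There are only finitely many edge-colored `m`-graphs on a finite vertex set. -/
instance {m : ℕ} {V : Type*} [Finite V] : Finite (EdgeColoredGraph m V) := by
  refine Finite.of_injective
    (β := (E : Finset (Finset V)) × (E → V)) (fun G => ⟨G.edges, G.color⟩) ?_
  rintro ⟨E, hE, c, hc⟩ ⟨E', hE', c', hc'⟩ h
  obtain ⟨h₁, h₂⟩ := Sigma.mk.inj h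
  subst h₁
  cases h₂
  rfl

/-- `g r n k` is the number of edge-colored `(r - 1)`-graphs with vertices and colors in an
`n`-element set whose extension, an `r`-graph, contains no loose cycle of length `k`. -/
noncomputable def g (r n k : ℕ) : ℕ :=
  Nat.card {G : EdgeColoredGraph (r - 1) (Fin n) // LooseCycleFree k G.extension}

end LooseCycles

namespace LooseCycles

/-! Write `r = p + 2` and `N = n ^ (p + 1)`. Call a complete `(p + 1)`-partite `(p + 1)`-graph with
parts of equal size `s` a box. The count rests on three facts about boxes.

Few colors (`card_image_boxEdges_le`): a colored box whose extension has no `C_k` uses only `O(s ^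
p)` colors on its `s ^ (p + 1)` edges. Otherwise, choosing one edge for each color outside the
vertex set of the box gives a family much larger than its shadow, hence a subfamily with large
codegrees. For `p ≥ 2` a cycle is embedded there greedily, and its distinct outside colors keep the
extended edges loose. For `p = 1` and `k` even the subfamily is a bipartite graph of large minimum
degree. It has a rainbow cycle of length `2` modulo `k - 2`, which chords of the box shorten to
length exactly `k`.

Few colorings (`card_colorings_boxEdges_le`): the color bound passes to sub-boxes, so the sides can
be halved repeatedly, each time choosing a palette for every piece. This gives at most `n ^ O(s ^ p)
* 2 ^ O(s ^ (p + 1))` colorings: a factor `log n` in the exponent is paid only on the lower order `s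
^ p`.

Large boxes (`exists_boxEdges_subset`): Erdős's box theorem finds in every nonempty `(p + 1)`-graph
`G` a box of side at least a constant times `(log n) ^ (1 / p) / (1 + log (N / |G|))`.

Boxes are removed from a given edge set one at a time. Each removed edge costs `O((log n) ^ ((p - 1)
/ p) * (1 + log (N / |G|)))` in the exponent, and by concavity of `u * (2 + log (N / u))` the
logarithmic weights add up to at most `3 * N`. Summing over the edge sets multiplies by at most `2 ^
N`, which is absorbed. -/

/-! ### Boxes in dense families of tuples -/

/-- Double counting of pairs `(x, S)` with `S ⊆ N x`, followed by averaging over `S`. This is the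
Kővári–Sós–Turán step that produces one side of a box. -/
theorem exists_common_neighborhood {X V : Type*} [Fintype X] [Fintype V] [Nonempty V]
    [DecidableEq V]
    (N : X → Finset V) (s : ℕ) (d : ℝ) (hd : 0 < d) (hd1 : d ≤ 1)
    (hsum : d * (Fintype.card V : ℝ) * Fintype.card X ≤ ∑ x, ((N x).card : ℝ))
    (hs : 4 * (s : ℝ) ≤ d * Fintype.card V) :
    ∃ S : Finset V, S.card = s ∧
      (d / 4) ^ (s + 1) * (Fintype.card X : ℝ) ≤ (Finset.univ.filter fun x => S ⊆ N x).card := by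
  classical
  set n := Fintype.card V with hn
  set M := Fintype.card X with hM
  -- The vertices of at least half the average degree; they make up a proportion at least `d / 2` of
  -- `X`.
  set A : Finset X := Finset.univ.filter fun x => d / 2 * n ≤ (N x).card with hA
  have hnpos : (0 : ℝ) < n := by exact_mod_cast Fintype.card_pos
  have hAcard : d / 2 * M ≤ A.card := by
    have h1 : ∑ x, ((N x).card : ℝ) ≤ A.card * n + M * (d / 2 * n) := by
      rw [← Finset.sum_filter_add_sum_filter_not Finset.univ (fun x => d / 2 * n ≤ (N x).card)]
      refine add_le_add ?_ ?_
      · refine (Finset.sum_le_card_nsmul _ _ (n : ℝ) ?_).trans ?_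
        · intro x _
          exact_mod_cast Finset.card_le_univ _
        · rw [nsmul_eq_mul]
      · refine (Finset.sum_le_card_nsmul _ _ (d / 2 * n) ?_).trans ?_
        · intro x hx
          exact (not_le.1 (Finset.mem_filter.1 hx).2).le
        · rw [nsmul_eq_mul]
          refine mul_le_mul_of_nonneg_right ?_ (by positivity)
          exact_mod_cast Finset.card_le_univ _
    have h2 : d / 2 * M * n ≤ A.card * n := by nlinarith
    exact le_of_mul_le_mul_right h2 hnpos
  -- Since `s ≤ d * n / 4`, each factor of the falling factorial of the degree is at least `d * n /
  -- 4`.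
  have hdeg : ∀ x ∈ A, (d / 4) ^ s * (n.choose s : ℝ) ≤ ((N x).card.choose s : ℝ) := by
    intro x hx
    have hx' : d / 2 * n ≤ (N x).card := (Finset.mem_filter.1 hx).2
    set m := (N x).card
    have hsm : (s : ℝ) ≤ m := by nlinarith
    have hsm' : s ≤ m := by exact_mod_cast hsm
    have hfac : (0 : ℝ) < (s.factorial : ℝ) := by exact_mod_cast s.factorial_pos
    have e1 : (m.descFactorial s : ℝ) = s.factorial * m.choose s := by
      exact_mod_cast Nat.descFactorial_eq_factorial_mul_choose m s
    have e2 : (n.descFactorial s : ℝ) = s.factorial * n.choose s := by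
      exact_mod_cast Nat.descFactorial_eq_factorial_mul_choose n s
    have e3 : (n.descFactorial s : ℝ) ≤ (n : ℝ) ^ s := by
      exact_mod_cast Nat.descFactorial_le_pow n s
    have e4 : ((m : ℝ) + 1 - s) ^ s ≤ (m.descFactorial s : ℝ) := by
      have := Nat.pow_sub_le_descFactorial m s
      have h : (((m + 1 - s : ℕ) : ℝ)) ^ s ≤ (m.descFactorial s : ℝ) := by exact_mod_cast this
      rwa [Nat.cast_sub (by omega), Nat.cast_add, Nat.cast_one] at h
    have e5 : (d / 4 * n) ^ s ≤ ((m : ℝ) + 1 - s) ^ s :=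
      pow_le_pow_left₀ (by positivity) (by linarith) _
    have e6 : (d / 4) ^ s * (n.descFactorial s : ℝ) ≤ (m.descFactorial s : ℝ) := by
      refine le_trans ?_ (e5.trans e4)
      rw [mul_pow]
      exact mul_le_mul_of_nonneg_left e3 (by positivity)
    rw [e1, e2] at e6
    nlinarith
  have hdouble : ∑ x ∈ A, ((N x).card.choose s) ≤
      ∑ S ∈ Finset.powersetCard s (Finset.univ : Finset V),
        (Finset.univ.filter fun x => S ⊆ N x).card := by
    have h1 : ∀ x ∈ A, (N x).card.choose s =
        ((Finset.powersetCard s (Finset.univ : Finset V)).filter fun S => S ⊆ N x).card := by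
      intro x _
      rw [← Finset.card_powersetCard]
      congr 1
      ext S
      simp [Finset.mem_powersetCard, and_comm]
    rw [Finset.sum_congr rfl h1]
    simp only [Finset.card_filter]
    rw [Finset.sum_comm]
    refine Finset.sum_le_sum fun S _ => ?_
    exact Finset.sum_le_sum_of_subset (Finset.subset_univ A)
  have hsn : s ≤ n := by
    have : (s : ℝ) ≤ n := by nlinarith
    exact_mod_cast this
  by_contra! hcon
  have hlt : ∑ S ∈ Finset.powersetCard s (Finset.univ : Finset V),
      ((Finset.univ.filter fun x => S ⊆ N x).card : ℝ) <
        ∑ S ∈ Finset.powersetCard s (Finset.univ : Finset V), (d / 4) ^ (s + 1) * (M : ℝ) := by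
    refine Finset.sum_lt_sum_of_nonempty ?_ fun S hS => hcon S (Finset.mem_powersetCard.1 hS).2
    exact Finset.powersetCard_nonempty.2 (by simpa using hsn)
  rw [Finset.sum_const, Finset.card_powersetCard, Finset.card_univ, nsmul_eq_mul] at hlt
  have hge : (A.card : ℝ) * ((d / 4) ^ s * (n.choose s : ℝ)) ≤
      ∑ S ∈ Finset.powersetCard s (Finset.univ : Finset V),
        ((Finset.univ.filter fun x => S ⊆ N x).card : ℝ) := by
    rw [← nsmul_eq_mul]
    refine (Finset.card_nsmul_le_sum A _ _ hdeg).trans ?_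
    exact_mod_cast hdouble
  have hp : 0 ≤ (d / 4) ^ s * (n.choose s : ℝ) := by positivity
  have h3 : d / 4 * M ≤ A.card := by
    refine le_trans ?_ hAcard
    have : (0 : ℝ) ≤ M := Nat.cast_nonneg _
    nlinarith
  have h4 := mul_le_mul_of_nonneg_right h3 hp
  have h5 : d / 4 * M * ((d / 4) ^ s * (n.choose s : ℝ)) =
      (n.choose s : ℝ) * ((d / 4) ^ (s + 1) * (M : ℝ)) := by ring
  exact absurd hlt (not_lt.2 (by rw [← h5]; exact h4.trans hge))

/-- A dense set of tuples contains a large box. -/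
theorem exists_box_subset {V : Type*} [Fintype V] [Nonempty V] [DecidableEq V] (s : ℕ)
    (hs : 1 ≤ s) (q : ℕ) : ∀ (d : ℝ) (H : Finset (Fin (q + 1) → V)), 0 < d → d ≤ 1 →
      d * (Fintype.card V : ℝ) ^ (q + 1) ≤ H.card →
      4 * (s : ℝ) ≤ Fintype.card V * (d / 16) ^ ((2 * s) ^ q) →
      ∃ S : Fin (q + 1) → Finset V, (∀ i, (S i).card = s) ∧ Fintype.piFinset S ⊆ H := by
  have hncard : (0 : ℝ) < Fintype.card V := by exact_mod_cast Fintype.card_pos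
  induction q with
  | zero =>
    intro d H hd hd1 hH hbig
    simp only [pow_zero, pow_one, zero_add] at hH hbig
    have hsH : s ≤ (H.image fun x => x 0).card := by
      rw [Finset.card_image_of_injective _ fun x y h => ?_]
      · have : (s : ℝ) ≤ H.card := by nlinarith
        exact_mod_cast this
      · ext i
        obtain rfl : i = 0 := Fin.fin_one_eq_zero i
        exact h
    obtain ⟨S, hS, hcard⟩ := Finset.exists_subset_card_eq hsH
    refine ⟨fun _ => S, fun _ => hcard, fun x hx => ?_⟩
    obtain ⟨y, hy, hyx⟩ := Finset.mem_image.1 (hS (Fintype.mem_piFinset.1 hx 0))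
    have : y = x := by
      ext i
      obtain rfl : i = 0 := Fin.fin_one_eq_zero i
      exact hyx
    exact this ▸ hy
  | succ q ih =>
    intro d H hd hd1 hH hbig
    have hd16 : d / 16 ≤ 1 := by linarith
    have h16 : (d / 16) ^ ((2 * s) ^ (q + 1)) ≤ d / 16 := by
      conv_rhs => rw [← pow_one (d / 16)]
      exact pow_le_pow_of_le_one (by positivity) hd16 (Nat.one_le_pow _ _ (by omega))
    let N : (Fin (q + 1) → V) → Finset V := fun x =>
      Finset.univ.filter fun v => (Fin.cons v x : Fin (q + 2) → V) ∈ H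
    have hsumN : ∑ x, (N x).card = H.card := by
      have h1 : ∀ x, (N x).card = (H.filter fun y => Fin.tail y = x).card := by
        intro x
        refine Finset.card_bij (fun v _ => Fin.cons v x) ?_ ?_ ?_
        · intro v hv
          simpa [N] using hv
        · intro v _ w _ h
          exact (Fin.cons_inj.1 h).1
        · intro y hy
          obtain ⟨hy1, rfl⟩ := Finset.mem_filter.1 hy
          exact ⟨y 0, by simpa [N] using hy1, Fin.cons_self_tail y⟩
      rw [Finset.sum_congr rfl fun x _ => h1 x]
      exact (Finset.card_eq_sum_card_fiberwise fun _ _ => Finset.mem_univ _).symm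
    obtain ⟨S, hS, hcard⟩ := exists_common_neighborhood N s d hd hd1
      (by
        have h2 : ∑ x, ((N x).card : ℝ) = H.card := by exact_mod_cast hsumN
        rw [h2]
        refine le_trans (le_of_eq ?_) hH
        rw [Fintype.card_fun, Fintype.card_fin]
        push_cast
        ring)
      (by nlinarith)
    rw [Fintype.card_fun, Fintype.card_fin] at hcard
    push_cast at hcard
    -- The common neighborhood has density `(d / 4) ^ (s + 1)`. Divided by `16` this is at least `(d
    -- / 16) ^ (2 * s)`, which accounts for one factor `2 * s` in the tower exponent.
    obtain ⟨T, hT, hTH⟩ := ih ((d / 4) ^ (s + 1)) _ (by positivity)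
      (pow_le_one₀ (by positivity) (by linarith)) hcard (by
        refine hbig.trans (mul_le_mul_of_nonneg_left ?_ hncard.le)
        rw [pow_succ' (2 * s) q, pow_mul]
        refine pow_le_pow_left₀ (by positivity) ?_ _
        have e1 : (d / 16) ^ (2 * s) = (d / 4) ^ (2 * s) * (1 / 4) ^ (2 * s) := by
          rw [← mul_pow]; congr 1; ring
        rw [e1, div_eq_mul_one_div ((d / 4) ^ (s + 1))]
        refine mul_le_mul ?_ ?_ (by positivity) (by positivity)
        · exact pow_le_pow_of_le_one (by positivity) (by linarith) (by omega)
        · calc ((1 : ℝ) / 4) ^ (2 * s) ≤ (1 / 4) ^ 2 :=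
              pow_le_pow_of_le_one (by positivity) (by norm_num) (by omega)
            _ = 1 / 16 := by norm_num)
    refine ⟨Fin.cons S T, ?_, ?_⟩
    · intro i
      refine Fin.cases ?_ (fun i => ?_) i
      · simpa using hS
      · simpa using hT i
    · intro x hx
      rw [Fintype.mem_piFinset] at hx
      have h1 : Fin.tail x ∈ Fintype.piFinset T := by
        rw [Fintype.mem_piFinset]
        intro i
        simpa [Fin.tail] using hx i.succ
      have h2 := (Finset.mem_filter.1 (hTH h1)).2 (by simpa using hx 0 : x 0 ∈ S)
      simpa [N] using h2

/-! ### Counting colorings of a box by repeated halving -/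

/-- The function that agrees with `f` on `X` and takes the default value outside `X`. -/
def cut {ι α : Type*} [DecidableEq ι] [Inhabited α] (X : Finset ι) (f : ι → α) (x : ι) : α :=
  if x ∈ X then f x else default

theorem cut_of_mem {ι α : Type*} [DecidableEq ι] [Inhabited α] {X : Finset ι} {f : ι → α} {x : ι}
    (hx : x ∈ X) : cut X f x = f x := if_pos hx

theorem cut_of_notMem {ι α : Type*} [DecidableEq ι] [Inhabited α] {X : Finset ι} {f : ι → α}
    {x : ι} (hx : x ∉ X) : cut X f x = default := if_neg hx

open Classical in
/-- The colorings of the box with sides `S` by colors in `P`, extended by a default value, for which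
every sub-box with all sides of length `2 ^ j` has at most `C * (2 ^ j) ^ p` colors. -/
noncomputable def boxColorings {V α : Type*} [Fintype V] [Fintype α] [Inhabited α] [DecidableEq V]
    [DecidableEq α] {p : ℕ}
    (C : ℕ) (S : Fin (p + 1) → Finset V) (P : Finset α) : Finset ((Fin (p + 1) → V) → α) :=
  Finset.univ.filter fun f =>
    (∀ x ∉ Fintype.piFinset S, f x = default) ∧ (∀ x ∈ Fintype.piFinset S, f x ∈ P) ∧
    ∀ (j : ℕ) (T : Fin (p + 1) → Finset V), (∀ i, T i ⊆ S i) → (∀ i, (T i).card = 2 ^ j) →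
      ((Fintype.piFinset T).image f).card ≤ C * (2 ^ j) ^ p

theorem mem_boxColorings {V α : Type*} [Fintype V] [Fintype α] [Inhabited α] [DecidableEq V]
    [DecidableEq α] {p C : ℕ} {S : Fin (p + 1) → Finset V} {P : Finset α}
    {f : (Fin (p + 1) → V) → α} :
    f ∈ boxColorings C S P ↔
      (∀ x ∉ Fintype.piFinset S, f x = default) ∧ (∀ x ∈ Fintype.piFinset S, f x ∈ P) ∧
      ∀ (j : ℕ) (T : Fin (p + 1) → Finset V), (∀ i, T i ⊆ S i) → (∀ i, (T i).card = 2 ^ j) →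
        ((Fintype.piFinset T).image f).card ≤ C * (2 ^ j) ^ p := by
  simp only [boxColorings, Finset.mem_filter, Finset.mem_univ, true_and]

/-- Split every side in two: each of the `2 ^ (p + 1)` pieces selects its own palette inside `P` in
at most `2 ^ |P|` ways. The multiplier on the left is a negative term of order `s ^ p` in the
exponent, kept as a product; it pays for the palette choices at every level. -/
theorem card_boxColorings_mul_le {V α : Type*} [Fintype V] [Fintype α] [Inhabited α]
    [DecidableEq V] [DecidableEq α] (p C : ℕ) (j : ℕ) :
    ∀ (S : Fin (p + 1) → Finset V) (P : Finset α), (∀ i, (S i).card = 2 ^ j) →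
      P.card ≤ C * (2 ^ j) ^ p →
      (boxColorings C S P).card * 2 ^ (C * 2 ^ (p + 1) * (2 ^ j) ^ p) ≤
        2 ^ ((C * 2 ^ (p + 1) + C) * (2 ^ j) ^ (p + 1)) := by
  induction j with
  | zero =>
    intro S P hS hP
    simp only [pow_zero, one_pow, mul_one] at hP ⊢
    have hx : ∀ i, ∃ v, S i = {v} := fun i => Finset.card_eq_one.1 (by simpa using hS i)
    choose x hx using hx
    have hmem : ∀ y, y ∈ Fintype.piFinset S ↔ y = x := by
      intro y
      rw [Fintype.mem_piFinset]
      constructor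
      · intro h
        ext i
        simpa [hx i] using h i
      · rintro rfl i
        simp [hx i]
    have hcard : (boxColorings C S P).card ≤ P.card := by
      refine Finset.card_le_card_of_injOn (fun f => f x) ?_ ?_
      · intro f hf
        exact (mem_boxColorings.1 hf).2.1 x ((hmem x).2 rfl)
      · intro f hf f' hf' h
        ext y
        by_cases hy : y ∈ Fintype.piFinset S
        · rw [(hmem y).1 hy]
          exact h
        · rw [(mem_boxColorings.1 hf).1 y hy, (mem_boxColorings.1 hf').1 y hy]
    calc (boxColorings C S P).card * 2 ^ (C * 2 ^ (p + 1))
        ≤ 2 ^ C * 2 ^ (C * 2 ^ (p + 1)) :=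
          Nat.mul_le_mul_right _ ((hcard.trans hP).trans Nat.lt_two_pow_self.le)
      _ = 2 ^ (C * 2 ^ (p + 1) + C) := by rw [← pow_add, add_comm]
  | succ j ih =>
    intro S P hS hP
    set L := C * 2 ^ (p + 1) with hL
    have hT : ∀ i, ∃ T : Bool → Finset V, (∀ b, T b ⊆ S i) ∧ (∀ b, (T b).card = 2 ^ j) ∧
        ∀ v ∈ S i, ∃ b, v ∈ T b := by
      intro i
      obtain ⟨A, hA, hAc⟩ := Finset.exists_subset_card_eq
        (show 2 ^ j ≤ (S i).card by rw [hS i]; exact Nat.pow_le_pow_right (by norm_num) (by omega))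
      refine ⟨fun b => if b then A else S i \ A, ?_, ?_, ?_⟩
      · rintro (_ | _)
        · simp
        · simpa using hA
      · rintro (_ | _)
        · simp [Finset.card_sdiff_of_subset hA, hS i, hAc, pow_succ, mul_two]
        · simpa using hAc
      · intro v hv
        by_cases h : v ∈ A
        · exact ⟨true, by simpa using h⟩
        · exact ⟨false, by simpa using ⟨hv, h⟩⟩
    choose T hTS hTc hTcov using hT
    let B : (Fin (p + 1) → Bool) → Fin (p + 1) → Finset V := fun β i => T i (β i)
    -- The possible palettes of one piece.
    let Q : Finset (Finset α) := P.powerset.filter fun P' => P'.card ≤ C * (2 ^ j) ^ p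
    have hinj : (boxColorings C S P).card ≤
        (Fintype.piFinset fun β => Q.sigma fun P' => boxColorings C (B β) P').card := by
      refine Finset.card_le_card_of_injOn
        (fun f β => ⟨(Fintype.piFinset (B β)).image f, cut (Fintype.piFinset (B β)) f⟩) ?_ ?_
      · intro f hf
        obtain ⟨h1, h2, h3⟩ := mem_boxColorings.1 hf
        rw [Finset.mem_coe, Fintype.mem_piFinset]
        intro β
        have hsub : Fintype.piFinset (B β) ⊆ Fintype.piFinset S :=
          Fintype.piFinset_subset _ _ fun i => hTS i _
        refine Finset.mem_sigma.2 ⟨?_, ?_⟩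
        · refine Finset.mem_filter.2 ⟨Finset.mem_powerset.2 ?_, ?_⟩
          · exact Finset.image_subset_iff.2 fun x hx => h2 x (hsub hx)
          · exact h3 j (B β) (fun i => hTS i _) fun i => hTc i _
        · refine mem_boxColorings.2 ⟨fun x hx => cut_of_notMem hx, fun x hx => ?_, ?_⟩
          · change cut (Fintype.piFinset (B β)) f x ∈ (Fintype.piFinset (B β)).image f
            rw [cut_of_mem hx]
            exact Finset.mem_image_of_mem _ hx
          · intro j' T' hT' hc
            rw [Finset.image_congr (g := f) fun x hx => cut_of_mem
              (Fintype.piFinset_subset _ _ hT' hx)]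
            exact h3 j' T' (fun i => (hT' i).trans (hTS i _)) hc
      · intro f hf f' hf' h
        ext x
        by_cases hx : x ∈ Fintype.piFinset S
        · choose β hβ using fun i => hTcov i (x i) (Fintype.mem_piFinset.1 hx i)
          have hxB : x ∈ Fintype.piFinset (B β) := Fintype.mem_piFinset.2 hβ
          have h4 := congrFun (eq_of_heq (Sigma.mk.inj (congrFun h β)).2) x
          rwa [cut_of_mem hxB, cut_of_mem hxB] at h4
        · rw [(mem_boxColorings.1 hf).1 x hx, (mem_boxColorings.1 hf').1 x hx]
    rw [Fintype.card_piFinset] at hinj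
    have hone : ∀ β, (Q.sigma fun P' => boxColorings C (B β) P').card * 2 ^ (L * (2 ^ j) ^ p) ≤
        2 ^ (C * (2 ^ (j + 1)) ^ p + (L + C) * (2 ^ j) ^ (p + 1)) := by
      intro β
      rw [Finset.card_sigma, Finset.sum_mul]
      refine (Finset.sum_le_card_nsmul Q _ (2 ^ ((L + C) * (2 ^ j) ^ (p + 1))) ?_).trans ?_
      · intro P' hP'
        exact ih (B β) P' (fun i => hTc i _) (Finset.mem_filter.1 hP').2
      · rw [smul_eq_mul, pow_add 2]
        refine Nat.mul_le_mul_right _ ((Finset.card_filter_le _ _).trans ?_)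
        rw [Finset.card_powerset]
        exact Nat.pow_le_pow_right (by norm_num) hP
    have hprod := Finset.prod_le_prod' (s := Finset.univ) fun β _ => hone β
    rw [Finset.prod_mul_distrib, Finset.prod_const, Finset.prod_const, Finset.card_univ,
      Fintype.card_fun, Fintype.card_bool, Fintype.card_fin, ← pow_mul 2 (L * (2 ^ j) ^ p), ← pow_mul 2 (C * _ + _)] at hprod
    have h5 := (Nat.mul_le_mul_right (2 ^ (L * (2 ^ j) ^ p * 2 ^ (p + 1))) hinj).trans hprod
    -- The pieces together supply the slack term of the larger box twice: one copy cancels the cost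
    -- of the palettes, the other remains as the slack of the new level.
    have e1 : L * (2 ^ j) ^ p * 2 ^ (p + 1) = L * (2 ^ (j + 1)) ^ p + L * (2 ^ (j + 1)) ^ p := by
      rw [pow_succ 2 j, mul_pow, pow_succ 2 p]; ring
    have e2 : (C * (2 ^ (j + 1)) ^ p + (L + C) * (2 ^ j) ^ (p + 1)) * 2 ^ (p + 1) =
        (L + C) * (2 ^ (j + 1)) ^ (p + 1) + L * (2 ^ (j + 1)) ^ p := by
      rw [hL, pow_succ 2 j, mul_pow, mul_pow]; ring
    rw [e1, e2, pow_add 2 (L * _), pow_add 2 ((L + C) * _), ← mul_assoc] at h5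
    exact Nat.le_of_mul_le_mul_right h5 (Nat.two_pow_pos _)

/-- The number of colorings of a box in which every sub-box has few colors. -/
theorem card_boxColorings_univ_le {V α : Type*} [Fintype V] [Fintype α] [Inhabited α]
    [DecidableEq V] [DecidableEq α] (p C : ℕ) (hC : 0 < C) (j : ℕ)
    (S : Fin (p + 1) → Finset V) (hS : ∀ i, (S i).card = 2 ^ j) :
    (boxColorings C S (Finset.univ : Finset α)).card ≤
      Fintype.card α ^ (C * (2 ^ j) ^ p) *
        2 ^ ((C * 2 ^ (p + 1) + C) * (2 ^ j) ^ (p + 1)) := by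
  set M := C * (2 ^ j) ^ p with hM
  have hMpos : 0 < M := by positivity
  have hsub : boxColorings C S (Finset.univ : Finset α) ⊆
      (Finset.univ : Finset (Fin M → α)).biUnion fun φ =>
        boxColorings C S (Finset.univ.image φ) := by
    intro f hf
    obtain ⟨h1, h2, h3⟩ := mem_boxColorings.1 hf
    have hc := h3 j S (fun _ => subset_rfl) hS
    -- The initial palette is listed by a map from `Fin M`, padded with the default color, so there
    -- are at most `|α| ^ M` choices.
    obtain ⟨φ, hφ⟩ : ∃ φ : Fin M → α, (Fintype.piFinset S).image f ⊆ Finset.univ.image φ := by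
      set I := (Fintype.piFinset S).image f
      refine ⟨fun i => if h : i.val < I.card then (I.equivFin.symm ⟨i, h⟩ : α) else default, ?_⟩
      intro a ha
      refine Finset.mem_image.2 ⟨⟨(I.equivFin ⟨a, ha⟩).val, ?_⟩, Finset.mem_univ _, ?_⟩
      · exact (I.equivFin ⟨a, ha⟩).isLt.trans_le hc
      · simp
    refine Finset.mem_biUnion.2 ⟨φ, Finset.mem_univ _, mem_boxColorings.2 ⟨h1, fun x hx => ?_, h3⟩⟩
    exact hφ (Finset.mem_image_of_mem _ hx)
  refine (Finset.card_le_card hsub).trans ((Finset.card_biUnion_le_card_mul _ _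
    (2 ^ ((C * 2 ^ (p + 1) + C) * (2 ^ j) ^ (p + 1))) ?_).trans ?_)
  · intro φ _
    have h := card_boxColorings_mul_le p C j S (Finset.univ.image φ) hS
      (Finset.card_image_le.trans (by simp [hM]))
    exact (Nat.le_mul_of_pos_right _ (by positivity)).trans h
  · rw [Finset.card_univ, Fintype.card_fun, Fintype.card_fin]

/-! ### Loose cycles in families with large codegrees -/

theorem val_finRotate {k : ℕ} (i : Fin k) :
    (finRotate k i).val = if i.val + 1 = k then 0 else i.val + 1 := by
  cases k with
  | zero => exact i.elim0
  | succ m =>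
    rw [coe_finRotate]
    by_cases h : i = Fin.last m
    · simp [h]
    · have : i.val ≠ m := fun h' => h (Fin.ext h')
      simp [h, this]

/-- Thickening the edges of a graph cycle by pairwise disjoint sets of new vertices gives a loose
cycle. -/
theorem isLooseCycle_of_cycle {V : Type*} [DecidableEq V] {k : ℕ} (hk : 3 ≤ k) (p : Fin k → V)
    (hp : Function.Injective p) (T : Fin k → Finset V)
    (hT : ∀ i j, i ≠ j → Disjoint (T i) (T j)) (hTp : ∀ i j, p j ∉ T i) :
    IsLooseCycle k (fun i => {p i, p (finRotate k i)} ∪ T i) (fun i => p (finRotate k i)) := by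
  have hr1 : ∀ i : Fin k, finRotate k i ≠ i := by
    intro i h
    have := congrArg Fin.val h
    rw [val_finRotate] at this
    split_ifs at this <;> omega
  have hr2 : ∀ i : Fin k, finRotate k (finRotate k i) ≠ i := by
    intro i h
    have := congrArg Fin.val h
    rw [val_finRotate, val_finRotate] at this
    split_ifs at this <;> omega
  have hpe : ∀ i j, p j ∈ ({p i, p (finRotate k i)} ∪ T i : Finset V) ↔
      j = i ∨ j = finRotate k i := by
    intro i j
    simp [hTp i j, hp.eq_iff]
  have hmem : ∀ i j x, i ≠ j → x ∈ ({p i, p (finRotate k i)} ∪ T i : Finset V) →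
      x ∈ ({p j, p (finRotate k j)} ∪ T j : Finset V) → ∃ a, x = p a := by
    intro i j x hij hi hj
    by_cases hxi : x ∈ T i
    · have hxj : x ∉ T j := Finset.disjoint_left.1 (hT i j hij) hxi
      simp only [Finset.mem_union, Finset.mem_insert, Finset.mem_singleton, hxj, or_false] at hj
      rcases hj with h | h <;> exact ⟨_, h⟩
    · simp only [Finset.mem_union, Finset.mem_insert, Finset.mem_singleton, hxi, or_false] at hi
      rcases hi with h | h <;> exact ⟨_, h⟩
  refine ⟨?_, ?_, ?_, ?_⟩
  · intro i j h
    by_contra hij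
    have h' : ({p i, p (finRotate k i)} ∪ T i : Finset V) = {p j, p (finRotate k j)} ∪ T j := h
    have h1 := (hpe j i).1 (h' ▸ (hpe i i).2 (Or.inl rfl))
    have h2 := (hpe j (finRotate k i)).1 (h' ▸ (hpe i _).2 (Or.inr rfl))
    rcases h1 with h1 | h1
    · exact hij h1
    · rcases h2 with h2 | h2
      · exact hr2 j (by rw [← h1]; exact h2)
      · exact hij ((finRotate k).injective h2)
  · exact fun i j h => (finRotate k).injective (hp h)
  · intro i
    ext x
    rw [Finset.mem_inter, Finset.mem_singleton]
    constructor
    · rintro ⟨h1, h2⟩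
      obtain ⟨a, rfl⟩ := hmem _ _ x (hr1 i).symm h1 h2
      rw [hpe] at h1 h2
      rcases h1 with rfl | rfl
      · rcases h2 with h2 | h2
        · exact absurd h2.symm (hr1 a)
        · exact absurd h2.symm (hr2 a)
      · rfl
    · rintro rfl
      exact ⟨(hpe _ _).2 (Or.inr rfl), (hpe _ _).2 (Or.inl rfl)⟩
  · intro i j hij hji hij'
    rw [Finset.disjoint_left]
    intro x h1 h2
    obtain ⟨a, rfl⟩ := hmem _ _ x hij h1 h2
    rw [hpe] at h1 h2
    rcases h1 with rfl | rfl
    · rcases h2 with h2 | h2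
      · exact hij h2
      · exact hij' h2
    · rcases h2 with h2 | h2
      · exact hji h2.symm
      · exact hij ((finRotate k).injective h2)

/-- All edges of `H` have `q` elements, and every set obtained from an edge by deleting a vertex
lies in at least `d` edges. -/
structure IsFull {V : Type*} [DecidableEq V] (q d : ℕ) (H : Finset (Finset V)) : Prop where
  card_eq : ∀ e ∈ H, e.card = q
  le_codegree : ∀ e ∈ H, ∀ v ∈ e, d ≤ (H.filter fun e' => e.erase v ⊆ e').card

/-- Take a subfamily maximizing `|A| - d * |∂A|`. If a shadow set had codegree below `d`, deleting
the edges above it would lose fewer than `d` edges and at least one shadow set, a contradiction. -/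
theorem exists_isFull_subset {V : Type*} [DecidableEq V] {q d : ℕ} {H : Finset (Finset V)}
    (hq : ∀ e ∈ H, e.card = q) (hH : d * H.shadow.card < H.card) :
    ∃ H' ⊆ H, H'.Nonempty ∧ IsFull q d H' := by
  obtain ⟨H', hH', hmax⟩ := Finset.exists_max_image H.powerset
    (fun A => (A.card : ℤ) - d * A.shadow.card) ⟨H, Finset.mem_powerset_self H⟩
  rw [Finset.mem_powerset] at hH'
  refine ⟨H', hH', ?_, fun e he => hq e (hH' he), ?_⟩
  -- The empty family has value `0`, while `H` itself has positive value.
  · rw [Finset.nonempty_iff_ne_empty]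
    rintro rfl
    have h1 := hmax H (Finset.mem_powerset_self H)
    simp only [Finset.card_empty, Finset.shadow_empty] at h1
    have h2 : ((d * H.shadow.card : ℕ) : ℤ) < H.card := by exact_mod_cast hH
    push_cast at h1 h2
    linarith
  · intro e he v hv
    by_contra! hlt
    set f := e.erase v
    set A := H'.filter fun e' => ¬ f ⊆ e' with hA
    have h1 := hmax A (Finset.mem_powerset.2 ((Finset.filter_subset _ _).trans hH'))
    have h2 : A.shadow ⊂ H'.shadow := by
      refine (Finset.ssubset_iff_of_subset
        (Finset.shadow_monotone (Finset.filter_subset _ _))).2 ⟨f, ?_, ?_⟩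
      · exact Finset.erase_mem_shadow he hv
      · intro hf
        obtain ⟨a, ha, b, hb, hab⟩ := Finset.mem_shadow_iff.1 hf
        exact (Finset.mem_filter.1 ha).2 (hab ▸ Finset.erase_subset _ _)
    have h3 := Finset.card_lt_card h2
    have h4 : (H'.filter fun e' => f ⊆ e').card + A.card = H'.card :=
      Finset.card_filter_add_card_filter_not _
    have h5 : (d : ℤ) * A.shadow.card + d ≤ d * H'.shadow.card := by
      have : (A.shadow.card : ℤ) + 1 ≤ H'.shadow.card := by exact_mod_cast h3
      nlinarith
    have h6 : ((H'.filter fun e' => f ⊆ e').card : ℤ) < d := by exact_mod_cast hlt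
    have h7 : ((H'.filter fun e' => f ⊆ e').card : ℤ) + A.card = H'.card := by exact_mod_cast h4
    linarith

/-- Delete from `e` a vertex outside `F`: the remaining face has at least `d` one-vertex extensions,
and `X` blocks fewer than `d` of them. -/
theorem IsFull.exists_insert_subset {V : Type*} [DecidableEq V] {q d : ℕ} {H : Finset (Finset V)}
    (hH : IsFull q d H) {F e X : Finset V} (he : e ∈ H) (hF : F ⊆ e) (hFq : F.card < q)
    (hX : X.card < d) : ∃ w, w ∉ X ∧ w ∉ F ∧ ∃ e' ∈ H, insert w F ⊆ e' := by
  obtain ⟨v, hv, hvF⟩ := Finset.exists_mem_notMem_of_card_lt_card (hFq.trans_eq (hH.card_eq e he).symm)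
  have hFf : F ⊆ e.erase v := Finset.subset_erase.2 ⟨hF, hvF⟩
  have hlt : (X.image fun w => insert w (e.erase v)).card <
      (H.filter fun e' => e.erase v ⊆ e').card :=
    (Finset.card_image_le.trans_lt hX).trans_le (hH.le_codegree e he v hv)
  obtain ⟨e', he', hne⟩ := Finset.exists_mem_notMem_of_card_lt_card hlt
  obtain ⟨he'H, hsub⟩ := Finset.mem_filter.1 he'
  obtain ⟨w, hw, rfl⟩ := Finset.exists_eq_insert_iff.2 ⟨hsub, by
    rw [Finset.card_erase_add_one hv, hH.card_eq e he, hH.card_eq e' he'H]⟩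
  refine ⟨w, fun hwX => hne (Finset.mem_image.2 ⟨w, hwX, rfl⟩), fun hwF => hw (hFf hwF), _, he'H, ?_⟩
  exact Finset.insert_subset_insert _ hFf

theorem IsFull.exists_edge_superset {V : Type*} [DecidableEq V] {q d : ℕ} {H : Finset (Finset V)}
    (hH : IsFull q d H) {X : Finset V} (hX : X.card < d) (m : ℕ) :
    ∀ F : Finset V, q - F.card = m → (∃ e ∈ H, F ⊆ e) →
      ∃ e ∈ H, F ⊆ e ∧ Disjoint (e \ F) X := by
  induction m with
  | zero =>
    rintro F hm ⟨e, he, hF⟩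
    have hFe : F = e := Finset.eq_of_subset_of_card_le hF (by rw [hH.card_eq e he]; omega)
    exact ⟨e, he, hF, by simp [hFe]⟩
  | succ m ih =>
    rintro F hm ⟨e, he, hF⟩
    obtain ⟨w, hwX, hwF, hw⟩ := hH.exists_insert_subset he hF (by omega) hX
    obtain ⟨e', he', hsub, hdisj⟩ := ih (insert w F)
      (by rw [Finset.card_insert_of_notMem hwF]; omega) hw
    refine ⟨e', he', (Finset.subset_insert _ _).trans hsub, ?_⟩
    rw [Finset.disjoint_left] at hdisj ⊢
    intro x hx hxX
    rw [Finset.mem_sdiff] at hx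
    refine hdisj (Finset.mem_sdiff.2 ⟨hx.1, ?_⟩) hxX
    rw [Finset.mem_insert]
    rintro (rfl | h)
    · exact hwX hxX
    · exact hx.2 h

/-- Keeping the hub `p 0` in every chosen edge ensures that the path can be closed: the last vertex
always shares an edge with `p 0`. Extending the pair `{p 0, p m}` to a triple is where `3 ≤ q`
enters. -/
theorem IsFull.exists_wheel {V : Type*} [DecidableEq V] {q d : ℕ} {H : Finset (Finset V)}
    (hH : IsFull q d H) (hq : 3 ≤ q) (hne : H.Nonempty) (m : ℕ) (hm : m < d) :
    ∃ p : ℕ → V, Set.InjOn p (Set.Iic m) ∧ (∃ e ∈ H, {p 0, p m} ⊆ e) ∧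
      ∀ i < m, ∃ e ∈ H, {p 0, p i, p (i + 1)} ⊆ e := by
  induction m with
  | zero =>
    obtain ⟨e, he⟩ := hne
    have : e.Nonempty := Finset.card_pos.1 (by rw [hH.card_eq e he]; omega)
    obtain ⟨a, ha⟩ := this
    exact ⟨fun _ => a, by simp [Set.InjOn], ⟨e, he, by simpa using ha⟩, by simp⟩
  | succ m ih =>
    obtain ⟨p, hp, ⟨e, he, hpe⟩, hpath⟩ := ih (by omega)
    obtain ⟨w, hwX, hwF, e', he', hsub⟩ := hH.exists_insert_subset he hpe
      (Finset.card_le_two.trans_lt (by omega)) (X := (Finset.range (m + 1)).image p)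
      (Finset.card_image_le.trans_lt (by simpa using hm))
    have hw : ∀ i, i ≤ m → p i ≠ w := fun i hi h =>
      hwX (Finset.mem_image.2 ⟨i, Finset.mem_range.2 (by omega), h⟩)
    have hu : ∀ i, i ≤ m → Function.update p (m + 1) w i = p i := fun i hi =>
      Function.update_of_ne (by omega) _ _
    have hu' : Function.update p (m + 1) w (m + 1) = w := Function.update_self ..
    refine ⟨Function.update p (m + 1) w, ?_, ?_, ?_⟩
    · intro i hi j hj hij
      rw [Set.mem_Iic] at hi hj
      rcases Nat.lt_or_ge m i with h1 | h1 <;> rcases Nat.lt_or_ge m j with h2 | h2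
      · omega
      · obtain rfl : i = m + 1 := by omega
        rw [hu', hu j h2] at hij
        exact absurd hij.symm (hw j h2)
      · obtain rfl : j = m + 1 := by omega
        rw [hu', hu i h1] at hij
        exact absurd hij (hw i h1)
      · rw [hu i h1, hu j h2] at hij
        exact hp h1 h2 hij
    · refine ⟨e', he', ?_⟩
      rw [hu', hu 0 (by omega)]
      intro x hx
      simp only [Finset.mem_insert, Finset.mem_singleton] at hx
      rcases hx with rfl | rfl <;> exact hsub (by simp)
    · intro i hi
      rw [hu i (by omega), hu 0 (by omega)]
      rcases Nat.lt_or_ge i m with h1 | h1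
      · rw [hu (i + 1) (by omega)]
        exact hpath i h1
      · obtain rfl : i = m := by omega
        rw [hu']
        refine ⟨e', he', ?_⟩
        intro x hx
        simp only [Finset.mem_insert, Finset.mem_singleton] at hx
        rcases hx with rfl | rfl | rfl <;> exact hsub (by simp)

/-- The wheel provides a cycle of pairs, each inside an edge. Each pair is completed greedily to an
edge whose new vertices avoid the `k` cycle vertices and the at most `k * q` vertices of the edges
already chosen. -/
theorem IsFull.exists_thick_cycle {V : Type*} [DecidableEq V] {q d k : ℕ} {H : Finset (Finset V)}
    (hH : IsFull q d H) (hq : 3 ≤ q) (hk : 3 ≤ k) (hne : H.Nonempty) (hd : k + k * q < d) :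
    ∃ (p : Fin k → V) (e : Fin k → Finset V), Function.Injective p ∧
      (∀ i, e i ∈ H ∧ {p i, p (finRotate k i)} ⊆ e i) ∧
      (∀ i j, p j ∉ e i \ {p i, p (finRotate k i)}) ∧
      ∀ i j, i ≠ j → Disjoint (e i \ {p i, p (finRotate k i)}) (e j) := by
  obtain ⟨p, hp, -, hpath⟩ := hH.exists_wheel hq hne (k - 1) (by omega)
  have hface : ∀ i : Fin k, ∃ e ∈ H, ({p i, p (finRotate k i)} : Finset V) ⊆ e := by
    intro i
    rw [val_finRotate]
    split_ifs with h
    · obtain ⟨e, he, hsub⟩ := hpath (k - 2) (by omega)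
      refine ⟨e, he, fun x hx => hsub ?_⟩
      rw [show k - 2 + 1 = i.val by omega]
      simp only [Finset.mem_insert, Finset.mem_singleton] at hx ⊢
      tauto
    · obtain ⟨e, he, hsub⟩ := hpath i (by omega)
      refine ⟨e, he, fun x hx => hsub ?_⟩
      simp only [Finset.mem_insert, Finset.mem_singleton] at hx ⊢
      tauto
  have hgreedy : ∀ I : Finset (Fin k), ∃ e : Fin k → Finset V,
      (∀ i ∈ I, e i ∈ H ∧ ({p i, p (finRotate k i)} : Finset V) ⊆ e i) ∧
      (∀ i ∈ I, ∀ j : Fin k, p j ∉ e i \ {p i, p (finRotate k i)}) ∧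
      ∀ i ∈ I, ∀ j ∈ I, i ≠ j → Disjoint (e i \ {p i, p (finRotate k i)}) (e j) := by
    intro I
    induction I using Finset.induction with
    | empty => exact ⟨fun _ => ∅, by simp⟩
    | insert a I ha ih =>
      obtain ⟨e, h1, h2, h3⟩ := ih
      set P : Finset V := (Finset.univ : Finset (Fin k)).image fun i : Fin k => p i with hP
      obtain ⟨e', he', hsub, hdisj⟩ := hH.exists_edge_superset (X := P ∪ I.biUnion e) (by
        refine lt_of_le_of_lt ((Finset.card_union_le _ _).trans (Nat.add_le_add
          (Finset.card_image_le.trans (by simp)) ((Finset.card_biUnion_le_card_mul _ _ q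
            fun i hi => (hH.card_eq _ (h1 i hi).1).le).trans ?_))) hd
        exact Nat.mul_le_mul_right _ ((Finset.card_le_univ _).trans (by simp))) _ _ rfl (hface a)
      have hP' : ∀ j : Fin k, p j ∈ P := fun j => Finset.mem_image.2 ⟨j, Finset.mem_univ _, rfl⟩
      rw [Finset.disjoint_union_right] at hdisj
      have hne : ∀ i ∈ I, i ≠ a := fun i hi h => ha (h ▸ hi)
      refine ⟨Function.update e a e', ?_, ?_, ?_⟩
      · intro i hi
        rcases Finset.mem_insert.1 hi with rfl | hi
        · rw [Function.update_self]; exact ⟨he', hsub⟩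
        · rw [Function.update_of_ne (hne i hi)]; exact h1 i hi
      · intro i hi j
        rcases Finset.mem_insert.1 hi with rfl | hi
        · rw [Function.update_self]
          exact fun h => Finset.disjoint_left.1 hdisj.1 h (hP' j)
        · rw [Function.update_of_ne (hne i hi)]; exact h2 i hi j
      · intro i hi j hj hij
        rcases Finset.mem_insert.1 hi with rfl | hi' <;> rcases Finset.mem_insert.1 hj with rfl | hj'
        · exact absurd rfl hij
        · rw [Function.update_self, Function.update_of_ne (hne j hj')]
          exact hdisj.2.mono_right (Finset.subset_biUnion_of_mem e hj')
        · rw [Function.update_self, Function.update_of_ne (hne i hi')]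
          rw [Finset.disjoint_left]
          intro x hx hx'
          by_cases hxa : x ∈ ({p j, p (finRotate k j)} : Finset V)
          · simp only [Finset.mem_insert, Finset.mem_singleton] at hxa
            rcases hxa with rfl | rfl <;> exact h2 i hi' _ hx
          · exact Finset.disjoint_left.1 hdisj.2 (Finset.mem_sdiff.2 ⟨hx', hxa⟩)
              (Finset.mem_biUnion.2 ⟨i, hi', (Finset.mem_sdiff.1 hx).1⟩)
        · rw [Function.update_of_ne (hne i hi'), Function.update_of_ne (hne j hj')]
          exact h3 i hi' j hj' hij
  obtain ⟨e, h1, h2, h3⟩ := hgreedy Finset.univ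
  refine ⟨fun i => p i, e, ?_, fun i => h1 i (Finset.mem_univ _),
    fun i j => h2 i (Finset.mem_univ _) j,
    fun i j => h3 i (Finset.mem_univ _) j (Finset.mem_univ _)⟩
  intro i j hij
  exact Fin.ext (hp (Set.mem_Iic.2 (by omega)) (Set.mem_Iic.2 (by omega)) hij)

/-- In a full family with distinct outside colors, the extended edges contain a loose cycle. -/
theorem IsFull.exists_looseCycle_extension {V : Type*} [DecidableEq V] {q d k : ℕ}
    {H : Finset (Finset V)} (hH : IsFull q d H) (hq : 3 ≤ q) (hk : 3 ≤ k) (hne : H.Nonempty)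
    (hd : k + k * q < d) {W : Finset V} (hW : ∀ e ∈ H, e ⊆ W) {z : Finset V → V}
    (hz : Set.InjOn z H) (hzW : ∀ e ∈ H, z e ∉ W) :
    ¬ LooseCycleFree k (H.image fun e => insert (z e) e) := by
  obtain ⟨p, e, hp, h1, h2, h3⟩ := hH.exists_thick_cycle hq hk hne hd
  rw [LooseCycleFree, not_not]
  -- Equal colors would force `e i = e j`; then the part of this edge off its cycle pair is disjoint
  -- from itself, leaving at most two vertices.
  have hne' : ∀ i j, i ≠ j → z (e i) ≠ z (e j) := by
    intro i j hij h
    have heq := hz (h1 i).1 (h1 j).1 h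
    have hd := h3 i j hij
    rw [← heq] at hd
    have hempty := Finset.disjoint_self_iff_empty _ |>.1 (hd.mono_right Finset.sdiff_subset)
    have hcard := Finset.card_le_card (Finset.sdiff_eq_empty_iff_subset.1 hempty)
    rw [hH.card_eq _ (h1 i).1] at hcard
    have := hcard.trans Finset.card_le_two
    omega
  have hWz : ∀ i j, z (e i) ∉ e j := fun i j h => hzW _ (h1 i).1 (hW _ (h1 j).1 h)
  refine ⟨_, _, fun i => ?_, isLooseCycle_of_cycle hk p hp
    (fun i => insert (z (e i)) (e i \ {p i, p (finRotate k i)})) ?_ ?_⟩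
  · refine Finset.mem_image.2 ⟨e i, (h1 i).1, ?_⟩
    rw [Finset.union_insert, Finset.union_sdiff_of_subset (h1 i).2]
  · intro i j hij
    rw [Finset.disjoint_insert_left, Finset.disjoint_insert_right, Finset.mem_insert, not_or]
    refine ⟨⟨hne' i j hij, fun h => hWz i j (Finset.mem_sdiff.1 h).1⟩,
      fun h => hWz j i (Finset.mem_sdiff.1 h).1, (h3 i j hij).mono_right Finset.sdiff_subset⟩
  · intro i j h
    rcases Finset.mem_insert.1 h with h | h
    · exact hWz i j (h ▸ (h1 j).2 (by simp))
    · exact h2 i j h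

/-! ### Rainbow cycles in complete bipartite graphs -/

/-- One of `a`, `b` lies in `A` and the other in `B`. -/
def Cross {V : Type*} (A B : Finset V) (a b : V) : Prop := (a ∈ A ∧ b ∈ B) ∨ (a ∈ B ∧ b ∈ A)

theorem Cross.symm {V : Type*} {A B : Finset V} {a b : V} (h : Cross A B a b) : Cross A B b a :=
  h.elim (fun h => Or.inr h.symm) fun h => Or.inl h.symm

/-- The cyclic successor on `{0, …, L - 1}`. -/
def next (L i : ℕ) : ℕ := if i + 1 < L then i + 1 else 0

theorem next_lt {L i : ℕ} (hi : i < L) : next L i < L := by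
  unfold next; split_ifs <;> omega

/-- The distinct vertices `u 0, …, u (L - 1)` form a cycle between `A` and `B` whose edges have
distinct colors, none of which is a vertex of the cycle. -/
structure RainbowCycle {V : Type*} [DecidableEq V] (A B : Finset V) (c : Finset V → V) (L : ℕ)
    (u : ℕ → V) : Prop where
  injOn : ∀ i < L, ∀ j < L, u i = u j → i = j
  cross : ∀ i < L, Cross A B (u i) (u (next L i))
  color_ne : ∀ i < L, ∀ j < L, c {u i, u (next L i)} ≠ u j
  color_injOn : ∀ i < L, ∀ j < L, c {u i, u (next L i)} = c {u j, u (next L j)} → i = j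

/-- The two sides alternate along the cycle, starting from `u 0`, which is joined to `u (L - 1)` by
the closing edge. -/
theorem RainbowCycle.cross_even {V : Type*} [DecidableEq V] {A B : Finset V} (hAB : Disjoint A B)
    {c : Finset V → V} {L : ℕ} {u : ℕ → V} (h : RainbowCycle A B c L u) (m : ℕ) :
    2 * m < L → Cross A B (u (L - 1)) (u (2 * m)) := by
  have hd : ∀ x, x ∈ A → x ∉ B := fun x hx => Finset.disjoint_left.1 hAB hx
  induction m with
  | zero =>
    intro hm
    have := h.cross (L - 1) (by omega)
    rwa [next, if_neg (by omega)] at this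
  | succ m ih =>
    intro hm
    have h0 := ih (by omega)
    have h1 := h.cross (2 * m) (by omega)
    have h2 := h.cross (2 * m + 1) (by omega)
    rw [next, if_pos (by omega)] at h1 h2
    have e : 2 * (m + 1) = 2 * m + 1 + 1 := by ring
    rw [e]
    unfold Cross at *
    have d1 := hd (u (2 * m))
    have d2 := hd (u (2 * m + 1))
    tauto

/-- Cutting a rainbow cycle along a chord. -/
theorem RainbowCycle.exists_shorter {V : Type*} [DecidableEq V] {A B : Finset V}
    (hAB : Disjoint A B) {c : Finset V → V} (hc : ∀ a b, Cross A B a b → c {a, b} ∉ ({a, b} : Finset V))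
    {l L : ℕ} (hl : 2 ≤ l) (hL : 2 * l < L) {u : ℕ → V} (h : RainbowCycle A B c L u) :
    (∃ u', RainbowCycle A B c (2 * l) u') ∨ ∃ u', RainbowCycle A B c (L - (2 * l - 2)) u' := by
  -- The chord splits the cycle into one of length `2 * l`, through `u 0, …, u (2 * l - 2), u (L -
  -- 1)`, and one of length `L - (2 * l - 2)`.
  have hchord : Cross A B (u (L - 1)) (u (2 * l - 2)) := by
    have := h.cross_even hAB (l - 1) (by omega)
    rwa [show 2 * (l - 1) = 2 * l - 2 by omega] at this
  have hcol := hc _ _ hchord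
  set x := c {u (L - 1), u (2 * l - 2)} with hx
  rw [Finset.mem_insert, Finset.mem_singleton, not_or] at hcol
  -- If the color of the chord collides with a vertex or an edge color of the short side, the
  -- rainbow property of the whole cycle excludes a collision on the long side. The two endpoints of
  -- the chord are excluded by `hcol`.
  by_cases hconf : (∃ j, j < 2 * l - 2 ∧ x = u j) ∨
      ∃ j, (j < 2 * l - 2 ∨ j = L - 1) ∧ x = c {u j, u (next L j)}
  · right
    refine ⟨fun i => u (i + (2 * l - 2)), ?_⟩
    set L' := L - (2 * l - 2) with hL'
    have hpair : ∀ i < L', (i + 1 < L' ∧ ({u (i + (2 * l - 2)), u (next L' i + (2 * l - 2))} : Finset V) =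
        {u (i + (2 * l - 2)), u (next L (i + (2 * l - 2)))}) ∨ (i = L' - 1 ∧
        ({u (i + (2 * l - 2)), u (next L' i + (2 * l - 2))} : Finset V) =
          {u (L - 1), u (2 * l - 2)}) := by
      intro i hi
      rcases Nat.lt_or_ge (i + 1) L' with h1 | h1
      · left
        refine ⟨h1, ?_⟩
        rw [next, next, if_pos h1, if_pos (by omega)]
        congr 3; omega
      · right
        refine ⟨by omega, ?_⟩
        rw [next, if_neg (by omega), zero_add]
        congr 2; omega
    have hx1 : ∀ j, 2 * l - 2 ≤ j → j < L → x ≠ u j := by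
      intro j hj hjL hxj
      rcases hconf with ⟨j', hj', hxj'⟩ | ⟨j', hj', hxj'⟩
      · have := h.injOn j hjL j' (by omega) (hxj ▸ hxj')
        omega
      · exact h.color_ne j' (by omega) j hjL (hxj' ▸ hxj)
    have hx2 : ∀ j, 2 * l - 2 ≤ j → j + 1 < L → x ≠ c {u j, u (next L j)} := by
      intro j hj hjL hxj
      rcases hconf with ⟨j', hj', hxj'⟩ | ⟨j', hj', hxj'⟩
      · exact h.color_ne j (by omega) j' (by omega) (hxj ▸ hxj')
      · have := h.color_injOn j (by omega) j' (by omega) (hxj ▸ hxj')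
        omega
    refine ⟨?_, ?_, ?_, ?_⟩
    · intro i hi j hj hij
      have := h.injOn _ (by omega) _ (by omega) hij
      omega
    · intro i hi
      rcases Nat.lt_or_ge (i + 1) L' with h1 | h1
      · have := h.cross (i + (2 * l - 2)) (by omega)
        rw [next, if_pos (by omega)] at this
        rw [next, if_pos (by omega)]
        convert this using 2; omega
      · rw [next, if_neg (by omega), zero_add]
        convert hchord using 2; omega
    · intro i hi j hj
      rcases hpair i hi with ⟨h1, h2⟩ | ⟨h1, h2⟩ <;> rw [h2]
      · exact h.color_ne _ (by omega) _ (by omega)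
      · exact hx1 _ (by omega) (by omega)
    · intro i hi j hj
      rcases hpair i hi with ⟨h1, h2⟩ | ⟨h1, h2⟩ <;> rcases hpair j hj with ⟨h3, h4⟩ | ⟨h3, h4⟩ <;>
        rw [h2, h4] <;> intro heq
      · have := h.color_injOn _ (by omega) _ (by omega) heq
        omega
      · exact absurd heq.symm (hx2 _ (by omega) (by omega))
      · exact absurd heq (hx2 _ (by omega) (by omega))
      · omega
  · left
    push Not at hconf
    obtain ⟨hc1, hc2⟩ := hconf
    -- Positions of the short cycle in the old one: after `2 * l - 2` it jumps along the chord to `L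
    -- - 1`.
    let t : ℕ → ℕ := fun i => if i < 2 * l - 1 then i else L - 1
    have ht : ∀ i < 2 * l, t i < L := by
      intro i hi
      simp only [t]
      split_ifs <;> omega
    have ht' : ∀ i < 2 * l, ∀ j < 2 * l, t i = t j → i = j := by
      intro i hi j hj
      simp only [t]
      split_ifs <;> omega
    have hpair : ∀ i < 2 * l, ((t i < 2 * l - 2 ∨ t i = L - 1) ∧ t (next (2 * l) i) = next L (t i)) ∨
        (i = 2 * l - 2 ∧ t i = 2 * l - 2 ∧ t (next (2 * l) i) = L - 1) := by
      intro i hi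
      simp only [t, next]
      split_ifs <;> omega
    have hx1 : ∀ i < 2 * l, x ≠ u (t i) := by
      intro i hi
      simp only [t]
      split_ifs with h1
      · rcases Nat.lt_or_ge i (2 * l - 2) with h2 | h2
        · exact hc1 i h2
        · obtain rfl : i = 2 * l - 2 := by omega
          exact hcol.2
      · exact hcol.1
    refine ⟨fun i => u (t i), ?_, ?_, ?_, ?_⟩
    · intro i hi j hj hij
      exact ht' i hi j hj (h.injOn _ (ht i hi) _ (ht j hj) hij)
    · intro i hi
      rcases hpair i hi with ⟨-, h2⟩ | ⟨-, h2, h3⟩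
      · rw [h2]; exact h.cross _ (ht i hi)
      · rw [h2, h3]; exact hchord.symm
    · intro i hi j hj
      rcases hpair i hi with ⟨-, h2⟩ | ⟨-, h2, h3⟩
      · rw [h2]; exact h.color_ne _ (ht i hi) _ (ht j hj)
      · rw [h2, h3, Finset.pair_comm]; exact hx1 j hj
    · intro i hi j hj heq
      rcases hpair i hi with ⟨h1, h2⟩ | ⟨h1, h2, h3⟩ <;>
        rcases hpair j hj with ⟨h4, h5⟩ | ⟨h4, h5, h6⟩
      · rw [h2, h5] at heq
        exact ht' i hi j hj (h.color_injOn _ (ht i hi) _ (ht j hj) heq)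
      · rw [h2, h5, h6, Finset.pair_comm (u (2 * l - 2))] at heq
        exact absurd heq.symm (hc2 _ h1)
      · rw [h5, h2, h3, Finset.pair_comm (u (2 * l - 2))] at heq
        exact absurd heq (hc2 _ h4)
      · omega

/-- Each cut either reaches length `2 * l` or lowers the length by `2 * l - 2`. The residue is
preserved, so the descent ends exactly at `2 * l`. -/
theorem exists_rainbowCycle_of_length_eq {V : Type*} [DecidableEq V] {A B : Finset V}
    (hAB : Disjoint A B) {c : Finset V → V} (hc : ∀ a b, Cross A B a b → c {a, b} ∉ ({a, b} : Finset V))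
    {l : ℕ} (hl : 2 ≤ l) (m : ℕ) :
    (∃ u, RainbowCycle A B c (2 * l + m * (2 * l - 2)) u) → ∃ u, RainbowCycle A B c (2 * l) u := by
  induction m with
  | zero => intro h; simpa using h
  | succ m ih =>
    rintro ⟨u, hu⟩
    rcases hu.exists_shorter hAB hc hl (by rw [add_one_mul m]; omega) with h | h
    · exact h
    · refine ih ?_
      rwa [show 2 * l + (m + 1) * (2 * l - 2) - (2 * l - 2) = 2 * l + m * (2 * l - 2) by
        rw [add_one_mul m]; omega] at h

theorem RainbowCycle.not_looseCycleFree {V : Type*} [DecidableEq V] {A B : Finset V}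
    {c : Finset V → V} {k : ℕ} (hk : 3 ≤ k) {u : ℕ → V} (h : RainbowCycle A B c k u)
    {E : Finset (Finset V)} (hE : ∀ a b, Cross A B a b → insert (c {a, b}) {a, b} ∈ E) :
    ¬ LooseCycleFree k E := by
  rw [LooseCycleFree, not_not]
  have hnext : ∀ i : Fin k, (finRotate k i).val = next k i := by
    intro i
    rw [val_finRotate, next]
    split_ifs <;> omega
  refine ⟨_, _, fun i => ?_, isLooseCycle_of_cycle hk (fun i => u i)
    (fun i j hij => Fin.ext (h.injOn _ i.isLt _ j.isLt hij))
    (fun i => {c {u i, u (finRotate k i)}}) ?_ ?_⟩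
  · have := hE _ _ (h.cross i i.isLt)
    rw [← hnext] at this
    convert this using 1
    rw [Finset.union_comm]
    rfl
  · intro i j hij
    rw [Finset.disjoint_singleton, hnext, hnext]
    exact fun heq => hij (Fin.ext (h.color_injOn _ i.isLt _ j.isLt heq))
  · intro i j hmem
    rw [Finset.mem_singleton, hnext] at hmem
    exact h.color_ne _ i.isLt _ j.isLt hmem.symm

theorem pair_next_injOn {V : Type*} [DecidableEq V] {L : ℕ} (hL : 3 ≤ L) {u : ℕ → V}
    (hu : ∀ i < L, ∀ j < L, u i = u j → i = j) {i j : ℕ} (hi : i < L) (hj : j < L)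
    (h : ({u i, u (next L i)} : Finset V) = {u j, u (next L j)}) : i = j := by
  have h1 : u i ∈ ({u j, u (next L j)} : Finset V) := h ▸ Finset.mem_insert_self _ _
  have h2 : u (next L i) ∈ ({u j, u (next L j)} : Finset V) := h ▸ by simp
  rw [Finset.mem_insert, Finset.mem_singleton] at h1 h2
  rcases h1 with h1 | h1
  · exact hu i hi j hj h1
  · have e1 := hu i hi _ (next_lt hj) h1
    rcases h2 with h2 | h2
    · have e2 := hu _ (next_lt hi) j hj h2
      unfold next at e1 e2
      split_ifs at e1 e2 <;> omega
    · have e2 := hu _ (next_lt hi) _ (next_lt hj) h2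
      unfold next at e1 e2
      split_ifs at e1 e2 <;> omega

/-- A full graph with distinct outside colors contains a rainbow cycle whose length is `2` modulo
`2 * l - 2`. -/
theorem IsFull.exists_rainbowCycle {V : Type*} [DecidableEq V] {A B : Finset V} {d l : ℕ}
    {H : Finset (Finset V)} (hH : IsFull 2 d H) (hl : 2 ≤ l) (hd : 2 * l ≤ d) (hne : H.Nonempty)
    {c : Finset V → V} (hHc : ∀ a b, {a, b} ∈ H → Cross A B a b) (hcW : ∀ e ∈ H, c e ∉ A ∪ B)
    (hcinj : Set.InjOn c H) :
    ∃ m u, RainbowCycle A B c (2 * l + m * (2 * l - 2)) u := by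
  by_contra hno
  -- Without such a cycle every path can be prolonged, which is impossible in a finite vertex set.
  have hpath : ∀ N : ℕ, ∃ p : ℕ → V, (∀ i ≤ N, ∀ j ≤ N, p i = p j → i = j) ∧
      (∃ e ∈ H, p N ∈ e) ∧ ∀ i < N, {p i, p (i + 1)} ∈ H := by
    intro N
    induction N with
    | zero =>
      obtain ⟨e, he⟩ := hne
      obtain ⟨a, ha⟩ : e.Nonempty := Finset.card_pos.1 (by rw [hH.card_eq e he]; omega)
      exact ⟨fun _ => a, by simp, ⟨e, he, ha⟩, by simp⟩
    | succ N ih =>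
      obtain ⟨p, hp, ⟨e, he, hpe⟩, hedge⟩ := ih
      let I := (Finset.range N).filter fun i => {p i, p N} ∈ H
      -- If the endpoint had more than `2 * l - 2` neighbors on the earlier path, two of them, `p i`
      -- and `p j`, would have positions congruent modulo `2 * l - 2`. The path from `p i` to `p j`,
      -- closed through `p N`, has length `j - i + 2`, in the required residue class.
      have hI : I.card ≤ 2 * l - 2 := by
        by_contra! hlt
        obtain ⟨i, hi, j, hj, hij, hmod⟩ := Finset.exists_ne_map_eq_of_card_lt_of_maps_to
          (s := I) (t := Finset.range (2 * l - 2)) (f := fun i => i % (2 * l - 2)) (by simpa using hlt)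
          (fun i _ => by
            simp only [Finset.coe_range, Set.mem_Iio]
            exact Nat.mod_lt _ (by omega))
        wlog hlt' : i < j generalizing i j
        · exact this j hj i hi hij.symm hmod.symm (by omega)
        obtain ⟨hi1, hi2⟩ := Finset.mem_filter.1 hi
        obtain ⟨hj1, hj2⟩ := Finset.mem_filter.1 hj
        rw [Finset.mem_range] at hi1 hj1
        obtain ⟨m, hm⟩ := (Nat.modEq_iff_dvd' hlt'.le).1 hmod
        have hm0 : m ≠ 0 := by
          rintro rfl
          omega
        obtain ⟨m, rfl⟩ := Nat.exists_eq_succ_of_ne_zero hm0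
        have hLeq : 2 * l + m * (2 * l - 2) = j - i + 2 := by
          rw [hm, Nat.mul_succ, mul_comm m]; omega
        refine hno ⟨m, fun t => if t ≤ j - i then p (i + t) else p N, ?_⟩
        rw [hLeq]
        set u : ℕ → V := fun t => if t ≤ j - i then p (i + t) else p N with hu
        have hu1 : ∀ t ≤ j - i, u t = p (i + t) := fun t ht => if_pos ht
        have hu2 : ∀ t, j - i < t → u t = p N := fun t ht => if_neg (by omega)
        have huinj : ∀ a < j - i + 2, ∀ b < j - i + 2, u a = u b → a = b := by
          intro a ha b hb hab
          simp only [hu] at hab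
          split_ifs at hab
          · have := hp _ (by omega) _ (by omega) hab
            omega
          · have := hp _ (by omega) _ (by omega) hab
            omega
          · have := hp _ (by omega) _ (by omega) hab
            omega
          · omega
        have hedges : ∀ a < j - i + 2, {u a, u (next (j - i + 2) a)} ∈ H := by
          intro a ha
          rcases lt_trichotomy a (j - i) with h1 | rfl | h1
          · rw [next, if_pos (by omega), hu1 a h1.le, hu1 (a + 1) (by omega), ← add_assoc]
            exact hedge _ (by omega)
          · rw [next, if_pos (by omega), hu1 _ le_rfl, hu2 _ (by omega),
              Nat.add_sub_of_le hlt'.le]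
            exact hj2
          · rw [next, if_neg (by omega), hu2 a h1, hu1 0 (by omega), Finset.pair_comm]
            exact hi2
        have hcross := fun a ha => hHc _ _ (hedges a ha)
        refine ⟨huinj, hcross, ?_, ?_⟩
        · intro a ha b hb heq
          refine hcW _ (hedges a ha) (heq ▸ ?_)
          rw [Finset.mem_union]
          rcases hcross b hb with h | h
          · exact Or.inl h.1
          · exact Or.inr h.1
        · intro a ha b hb heq
          exact pair_next_injOn (by omega) huinj ha hb (hcinj (hedges a ha) (hedges b hb) heq)
      obtain ⟨w, hwX, hwF, e', he', hsub⟩ := hH.exists_insert_subset he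
        (Finset.singleton_subset_iff.2 hpe) (by simp) (X := I.image p)
        (Finset.card_image_le.trans_lt (by omega))
      rw [Finset.mem_singleton] at hwF
      have hpair : ({w, p N} : Finset V) = e' :=
        Finset.eq_of_subset_of_card_le hsub (by rw [hH.card_eq e' he', Finset.card_pair hwF])
      have hw : ∀ i ≤ N, p i ≠ w := by
        rintro i hi rfl
        rcases hi.lt_or_eq with h | rfl
        · exact hwX (Finset.mem_image_of_mem _ (Finset.mem_filter.2
            ⟨Finset.mem_range.2 h, hpair ▸ he'⟩))
        · exact hwF rfl
      have hu : ∀ i, i ≤ N → Function.update p (N + 1) w i = p i := fun i hi =>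
        Function.update_of_ne (by omega) _ _
      have hu' : Function.update p (N + 1) w (N + 1) = w := Function.update_self ..
      refine ⟨Function.update p (N + 1) w, ?_, ⟨e', he', ?_⟩, ?_⟩
      · intro i hi j hj hij
        rcases Nat.lt_or_ge N i with h1 | h1 <;> rcases Nat.lt_or_ge N j with h2 | h2
        · omega
        · obtain rfl : i = N + 1 := by omega
          rw [hu', hu j h2] at hij
          exact absurd hij.symm (hw j h2)
        · obtain rfl : j = N + 1 := by omega
          rw [hu', hu i h1] at hij
          exact absurd hij (hw i h1)
        · rw [hu i h1, hu j h2] at hij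
          exact hp i h1 j h2 hij
      · rw [hu', ← hpair]; simp
      · intro i hi
        rw [hu i (by omega)]
        rcases Nat.lt_or_ge i N with h1 | h1
        · rw [hu (i + 1) (by omega)]
          exact hedge i h1
        · obtain rfl : i = N := by omega
          rw [hu', Finset.pair_comm, hpair]
          exact he'
  -- Only the first `(A ∪ B).card + 1` vertices are used, each the start of a path edge; these are
  -- already too many.
  obtain ⟨p, hp, -, hedge⟩ := hpath ((A ∪ B).card + 1)
  have hsub : (Finset.range ((A ∪ B).card + 1)).image p ⊆ A ∪ B := by
    intro x hx
    obtain ⟨i, hi, rfl⟩ := Finset.mem_image.1 hx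
    rw [Finset.mem_union]
    rcases hHc _ _ (hedge i (Finset.mem_range.1 hi)) with h | h
    · exact Or.inl h.1
    · exact Or.inr h.1
  have hcard := Finset.card_le_card hsub
  rw [Finset.card_image_of_injOn, Finset.card_range] at hcard
  · omega
  · intro i hi j hj hij
    rw [Finset.coe_range, Set.mem_Iio] at hi hj
    exact hp i (by omega) j (by omega) hij

/-! ### Cycle-free colorings of a box use few colors -/

theorem LooseCycleFree.mono {V : Type*} [DecidableEq V] {k : ℕ} {H H' : Finset (Finset V)}
    (h : LooseCycleFree k H) (hsub : H' ⊆ H) : LooseCycleFree k H' :=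
  fun ⟨e, v, he, hev⟩ => h ⟨e, v, fun i => hsub (he i), hev⟩

/-- The edges of the complete multipartite hypergraph with parts `S`. -/
def boxEdges {V : Type*} [DecidableEq V] {q : ℕ} (S : Fin q → Finset V) : Finset (Finset V) :=
  (Fintype.piFinset S).image fun x => Finset.univ.image x

theorem boxEdges_mono {V : Type*} [DecidableEq V] {q : ℕ} {S T : Fin q → Finset V}
    (h : ∀ i, T i ⊆ S i) : boxEdges T ⊆ boxEdges S :=
  Finset.image_subset_image (Fintype.piFinset_subset _ _ h)

theorem card_of_mem_boxEdges {V : Type*} [DecidableEq V] {q : ℕ} {S : Fin q → Finset V}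
    (hinj : ∀ x ∈ Fintype.piFinset S, Function.Injective x) {e : Finset V} (he : e ∈ boxEdges S) :
    e.card = q := by
  obtain ⟨x, hx, rfl⟩ := Finset.mem_image.1 he
  rw [Finset.card_image_of_injective _ (hinj x hx), Finset.card_univ, Fintype.card_fin]

theorem disjoint_of_forall_injective {V : Type*} [DecidableEq V] {q : ℕ} {S : Fin q → Finset V}
    (hne : ∀ i, (S i).Nonempty) (hinj : ∀ x ∈ Fintype.piFinset S, Function.Injective x)
    {i j : Fin q} (hij : i ≠ j) : Disjoint (S i) (S j) := by
  rw [Finset.disjoint_left]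
  intro v hi hj
  choose y hy using hne
  refine hij (hinj (fun t => if t = i ∨ t = j then v else y t) ?_ (by simp))
  rw [Fintype.mem_piFinset]
  intro t
  by_cases h : t = i ∨ t = j
  · rw [if_pos h]
    rcases h with rfl | rfl <;> assumption
  · rw [if_neg h]
    exact hy t

theorem image_injOn_piFinset {V : Type*} [DecidableEq V] {q : ℕ} {S : Fin q → Finset V}
    (hne : ∀ i, (S i).Nonempty) (hinj : ∀ x ∈ Fintype.piFinset S, Function.Injective x) :
    Set.InjOn (fun x : Fin q → V => Finset.univ.image x) (Fintype.piFinset S) := by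
  intro x hx y hy h
  rw [Finset.mem_coe, Fintype.mem_piFinset] at hx hy
  ext i
  have hi : x i ∈ Finset.univ.image y := by
    rw [← (show Finset.univ.image x = Finset.univ.image y from h)]
    exact Finset.mem_image_of_mem _ (Finset.mem_univ i)
  obtain ⟨j, -, hj⟩ := Finset.mem_image.1 hi
  by_cases hij : i = j
  · rw [hij, hj, ← hij]
  · exact absurd (hj ▸ hy j) (Finset.disjoint_left.1 (disjoint_of_forall_injective hne hinj hij) (hx i))

theorem card_boxEdges {V : Type*} [DecidableEq V] {q s : ℕ} {S : Fin q → Finset V} (hs : 0 < s)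
    (hS : ∀ i, (S i).card = s) (hinj : ∀ x ∈ Fintype.piFinset S, Function.Injective x) :
    (boxEdges S).card = s ^ q := by
  rw [boxEdges, Finset.card_image_of_injOn (image_injOn_piFinset
    (fun i => Finset.card_pos.1 (by rw [hS i]; exact hs)) hinj), Fintype.card_piFinset]
  simp [hS]

/-- The constant in the bound for the number of colors of a box. -/
def fewColorsConst (p k : ℕ) : ℕ := (p + 1) + (k + k * (p + 1) + 1) * (p + 1) ^ p

/-- A coloring of a complete multipartite hypergraph whose extension has no loose cycle has few
colors. -/
theorem card_image_boxEdges_le {V : Type*} [DecidableEq V] {p k s : ℕ} (hk : 3 ≤ k)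
    (hpk : (p = 1 ∧ Even k) ∨ 2 ≤ p) (hs : 0 < s) {S : Fin (p + 1) → Finset V}
    (hS : ∀ i, (S i).card = s) (hinj : ∀ x ∈ Fintype.piFinset S, Function.Injective x)
    {c : Finset V → V} (hc : ∀ e ∈ boxEdges S, c e ∉ e)
    (hfree : LooseCycleFree k ((boxEdges S).image fun e => insert (c e) e)) :
    ((boxEdges S).image c).card ≤ fewColorsConst p k * s ^ p := by
  -- Just above the codegree needed for the greedy embedding with edges of size `p + 1`; it also
  -- exceeds `k`, as the rainbow cycle argument requires.
  set d := k + k * (p + 1) + 1 with hd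
  set W : Finset V := Finset.univ.biUnion S with hW
  have hWcard : W.card ≤ (p + 1) * s := by
    refine (Finset.card_biUnion_le_card_mul _ _ s fun i _ => (hS i).le).trans ?_
    simp
  have hp : p ≠ 0 := by omega
  by_contra! hlt
  -- Discarding the colors inside `W` costs at most `(p + 1) * s ≤ (p + 1) * s ^ p`, the first
  -- summand of `fewColorsConst`.
  set Z := (boxEdges S).image c \ W with hZ
  have hZcard : d * W.card ^ p < Z.card := by
    have h1 := Finset.le_card_sdiff W ((boxEdges S).image c)
    have h2 : W.card ^ p ≤ ((p + 1) * s) ^ p := Nat.pow_le_pow_left hWcard p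
    have h3 : s ≤ s ^ p := Nat.le_self_pow hp s
    have h4 : d * W.card ^ p ≤ d * (p + 1) ^ p * s ^ p := by
      rw [mul_assoc, ← mul_pow]; exact Nat.mul_le_mul_left _ h2
    have h5 : W.card ≤ (p + 1) * s ^ p := hWcard.trans (Nat.mul_le_mul_left _ h3)
    rw [fewColorsConst, add_mul, ← hd] at hlt
    rw [← hZ] at h1
    omega
  have hrep : ∀ z, ∃ e, z ∈ Z → e ∈ boxEdges S ∧ c e = z := by
    intro z
    by_cases hz : z ∈ Z
    · obtain ⟨e, he, hez⟩ := Finset.mem_image.1 (Finset.mem_sdiff.1 hz).1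
      exact ⟨e, fun _ => ⟨he, hez⟩⟩
    · exact ⟨∅, fun h => absurd h hz⟩
  -- One representative edge per color makes the coloring injective on the chosen family.
  choose g hg using hrep
  have hHbox : Z.image g ⊆ boxEdges S := Finset.image_subset_iff.2 fun z hz => (hg z hz).1
  have hHZ : ∀ e ∈ Z.image g, c e ∈ Z := by
    intro e he
    obtain ⟨z, hz, rfl⟩ := Finset.mem_image.1 he
    rwa [(hg z hz).2]
  have hHinj : Set.InjOn c (Z.image g : Finset (Finset V)) := by
    intro e he e' he' h
    obtain ⟨z, hz, rfl⟩ := Finset.mem_image.1 he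
    obtain ⟨z', hz', rfl⟩ := Finset.mem_image.1 he'
    rw [(hg z hz).2, (hg z' hz').2] at h
    rw [h]
  have hHcard : (Z.image g).card = Z.card := by
    refine Finset.card_image_of_injOn fun z hz z' hz' h => ?_
    rw [← (hg z hz).2, ← (hg z' hz').2, h]
  have hHsize : ∀ e ∈ Z.image g, e.card = p + 1 := fun e he =>
    card_of_mem_boxEdges hinj (hHbox he)
  have hsubW : ∀ e ∈ boxEdges S, e ⊆ W := by
    intro e he
    obtain ⟨x, hx, rfl⟩ := Finset.mem_image.1 he
    refine Finset.image_subset_iff.2 fun i _ => ?_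
    exact Finset.mem_biUnion.2 ⟨i, Finset.mem_univ _, Fintype.mem_piFinset.1 hx i⟩
  have hshadow : (Z.image g).shadow.card ≤ W.card ^ p := by
    refine (Finset.card_le_card (t := Finset.powersetCard p W) fun f hf => ?_).trans
      (by rw [Finset.card_powersetCard]; exact Nat.choose_le_pow _ _)
    obtain ⟨e, he, v, hv, rfl⟩ := Finset.mem_shadow_iff.1 hf
    rw [Finset.mem_powersetCard, Finset.card_erase_of_mem hv, hHsize e he]
    exact ⟨(Finset.erase_subset _ _).trans (hsubW e (hHbox he)), rfl⟩
  obtain ⟨H, hHsub, hHne, hfull⟩ := exists_isFull_subset hHsize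
    ((Nat.mul_le_mul_left d hshadow).trans_lt (hZcard.trans_eq hHcard.symm))
  have hHW : ∀ e ∈ H, c e ∉ W := fun e he => (Finset.mem_sdiff.1 (hHZ e (hHsub he))).2
  have hHinj' : Set.InjOn c H := hHinj.mono (by exact_mod_cast hHsub)
  rcases hpk with ⟨rfl, l, hl⟩ | hp2
  · have hAB : Disjoint (S 0) (S 1) := disjoint_of_forall_injective
      (fun i => Finset.card_pos.1 (by rw [hS i]; exact hs)) hinj (by decide)
    have himage : ∀ x : Fin 2 → V, Finset.univ.image x = {x 0, x 1} := by
      intro x; ext v; simp [eq_comm]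
    have hcross : ∀ a b, Cross (S 0) (S 1) a b → {a, b} ∈ boxEdges S := by
      intro a b hab
      rcases hab with ⟨ha, hb⟩ | ⟨ha, hb⟩
      · refine Finset.mem_image.2 ⟨![a, b], ?_, by rw [himage]; rfl⟩
        simp [Fintype.mem_piFinset, Fin.forall_fin_two, ha, hb]
      · refine Finset.mem_image.2 ⟨![b, a], ?_, by rw [himage, Finset.pair_comm a]; rfl⟩
        simp [Fintype.mem_piFinset, Fin.forall_fin_two, ha, hb]
    have hcross' : ∀ a b, {a, b} ∈ boxEdges S → Cross (S 0) (S 1) a b := by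
      intro a b hab
      have hcard := card_of_mem_boxEdges hinj hab
      have hne : a ≠ b := by
        rintro rfl
        simp at hcard
      obtain ⟨x, hx, hxe⟩ := Finset.mem_image.1 hab
      rw [Fintype.mem_piFinset] at hx
      rw [himage] at hxe
      have h0 := hx 0
      have h1 := hx 1
      have ha : a ∈ ({x 0, x 1} : Finset V) := hxe ▸ by simp
      have hb : b ∈ ({x 0, x 1} : Finset V) := hxe ▸ by simp
      simp only [Finset.mem_insert, Finset.mem_singleton] at ha hb
      rcases ha with rfl | rfl <;> rcases hb with rfl | rfl
      · exact absurd rfl hne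
      · exact Or.inl ⟨h0, h1⟩
      · exact Or.inr ⟨h1, h0⟩
      · exact absurd rfl hne
    have hWAB : W = S 0 ∪ S 1 := by ext v; simp [hW, Fin.exists_fin_two]
    obtain ⟨m, hm⟩ := hfull.exists_rainbowCycle (l := l) (by omega) (by omega) hHne
      (fun a b h => hcross' a b (hHbox (hHsub h))) (fun e he => hWAB ▸ hHW e he) hHinj'
    obtain ⟨u, hu⟩ := exists_rainbowCycle_of_length_eq hAB
      (fun a b h => hc _ (hcross a b h)) (by omega) m hm
    rw [← two_mul] at hl
    rw [← hl] at hu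
    exact hu.not_looseCycleFree hk
      (fun a b h => Finset.mem_image.2 ⟨_, hcross a b h, rfl⟩) hfree
  · exact hfull.exists_looseCycle_extension (by omega) hk hHne (by omega)
      (fun e he => hsubW e (hHbox (hHsub he))) hHinj' hHW
      (hfree.mono (Finset.image_subset_image (hHsub.trans hHbox)))

/-! ### Cycle-free colorings of a fixed hypergraph -/

open Classical in
/-- The colorings of the hypergraph `G`, extended by a default value, whose extension contains no
loose cycle of length `k`. -/
noncomputable def colorings {V : Type*} [Fintype V] [Inhabited V] [DecidableEq V] (k : ℕ)
    (G : Finset (Finset V)) : Finset (Finset V → V) :=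
  Finset.univ.filter fun c => (∀ e ∉ G, c e = default) ∧ (∀ e ∈ G, c e ∉ e) ∧
    LooseCycleFree k (G.image fun e => insert (c e) e)

theorem mem_colorings {V : Type*} [Fintype V] [Inhabited V] [DecidableEq V] {k : ℕ}
    {G : Finset (Finset V)} {c : Finset V → V} :
    c ∈ colorings k G ↔ (∀ e ∉ G, c e = default) ∧ (∀ e ∈ G, c e ∉ e) ∧
      LooseCycleFree k (G.image fun e => insert (c e) e) := by
  simp [colorings]

theorem cut_mem_colorings {V : Type*} [Fintype V] [Inhabited V] [DecidableEq V] {k : ℕ}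
    {G K : Finset (Finset V)} (hK : K ⊆ G) {c : Finset V → V} (hc : c ∈ colorings k G) :
    cut K c ∈ colorings k K := by
  obtain ⟨-, h2, h3⟩ := mem_colorings.1 hc
  refine mem_colorings.2 ⟨fun e he => cut_of_notMem he, fun e he => ?_, ?_⟩
  · rw [cut_of_mem he]
    exact h2 e (hK he)
  · rw [Finset.image_congr (g := fun e => insert (c e) e) fun e he => by
      simp only [cut_of_mem (Finset.mem_coe.1 he)]]
    exact h3.mono (Finset.image_subset_image hK)

/-- A coloring is determined by its restrictions to `K` and `G \ K`, and both inherit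
cycle-freeness. This allows boxes to be removed one by one. -/
theorem card_colorings_le_mul {V : Type*} [Fintype V] [Inhabited V] [DecidableEq V] (k : ℕ)
    {G K : Finset (Finset V)} (hK : K ⊆ G) :
    (colorings k G).card ≤ (colorings k K).card * (colorings k (G \ K)).card := by
  rw [← Finset.card_product]
  refine Finset.card_le_card_of_injOn (fun c => (cut K c, cut (G \ K) c)) ?_ ?_
  · intro c hc
    exact Finset.mem_coe.2 (Finset.mem_product.2
      ⟨cut_mem_colorings hK hc, cut_mem_colorings Finset.sdiff_subset hc⟩)
  · intro c hc c' hc' h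
    obtain ⟨h1, h2⟩ := Prod.mk.inj h
    ext e
    by_cases heK : e ∈ K
    · have := congrFun h1 e
      rwa [cut_of_mem heK, cut_of_mem heK] at this
    · by_cases heG : e ∈ G
      · have := congrFun h2 e
        have hm : e ∈ G \ K := Finset.mem_sdiff.2 ⟨heG, heK⟩
        rwa [cut_of_mem hm, cut_of_mem hm] at this
      · rw [(mem_colorings.1 hc).1 e heG, (mem_colorings.1 hc').1 e heG]

/-- Cycle-freeness passes to every sub-box, so the color bound holds at all dyadic scales; this is
the condition defining `boxColorings`. -/
theorem card_colorings_boxEdges_le {V : Type*} [Fintype V] [Inhabited V] [DecidableEq V]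
    {p k j : ℕ} (hk : 3 ≤ k) (hpk : (p = 1 ∧ Even k) ∨ 2 ≤ p) {S : Fin (p + 1) → Finset V}
    (hS : ∀ i, (S i).card = 2 ^ j) (hinj : ∀ x ∈ Fintype.piFinset S, Function.Injective x) :
    (colorings k (boxEdges S)).card ≤ Fintype.card V ^ (fewColorsConst p k * (2 ^ j) ^ p) *
      2 ^ ((fewColorsConst p k * 2 ^ (p + 1) + fewColorsConst p k) * (2 ^ j) ^ (p + 1)) := by
  refine le_trans ?_ (card_boxColorings_univ_le p (fewColorsConst p k)
    (by unfold fewColorsConst; omega) j S hS)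
  refine Finset.card_le_card_of_injOn
    (fun c => cut (Fintype.piFinset S) fun x => c (Finset.univ.image x)) ?_ ?_
  · intro c hc
    refine mem_boxColorings.2 ⟨fun x hx => cut_of_notMem hx, fun _ _ => Finset.mem_univ _, ?_⟩
    intro j' T hT hTc
    have hTS : Fintype.piFinset T ⊆ Fintype.piFinset S := Fintype.piFinset_subset _ _ hT
    obtain ⟨-, h2, h3⟩ := mem_colorings.1 hc
    have himg : (Fintype.piFinset T).image
        (cut (Fintype.piFinset S) fun x => c (Finset.univ.image x)) =
          (Fintype.piFinset T).image fun x => c (Finset.univ.image x) :=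
      Finset.image_congr fun x hx => cut_of_mem (hTS hx)
    refine (congrArg Finset.card himg).trans_le ?_
    have h4 := card_image_boxEdges_le hk hpk (pow_pos two_pos j') hTc
      (fun x hx => hinj x (hTS hx)) (fun e he => h2 e (boxEdges_mono hT he))
      (h3.mono (Finset.image_subset_image (boxEdges_mono hT)))
    rwa [boxEdges, Finset.image_image] at h4
  · intro c hc c' hc' h
    ext e
    by_cases he : e ∈ boxEdges S
    · obtain ⟨x, hx, rfl⟩ := Finset.mem_image.1 he
      have h5 := congrFun h x
      simpa only [cut_of_mem hx] using h5
    · rw [(mem_colorings.1 hc).1 e he, (mem_colorings.1 hc').1 e he]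

theorem card_le_card_pow {V : Type*} [Fintype V] {q : ℕ} {G : Finset (Finset V)}
    (hG : ∀ e ∈ G, e.card = q) : (G.card : ℝ) ≤ (Fintype.card V : ℝ) ^ q := by
  have h1 : G ⊆ Finset.powersetCard q Finset.univ := fun e he =>
    Finset.mem_powersetCard.2 ⟨Finset.subset_univ _, hG e he⟩
  have h2 := Finset.card_le_card h1
  rw [Finset.card_powersetCard, Finset.card_univ] at h2
  exact_mod_cast h2.trans (Nat.choose_le_pow _ _)

/-- Every `(p + 1)`-uniform hypergraph contains a large complete multipartite hypergraph with parts
of equal size, a power of two. -/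
theorem exists_boxEdges_subset {V : Type*} [Fintype V] [Nonempty V] [DecidableEq V] {p : ℕ}
    (hp : 1 ≤ p) {y : ℝ} (hy : 1 ≤ y) (hyn : y ^ p = Real.log (Fintype.card V))
    {G : Finset (Finset V)} (hG : ∀ e ∈ G, e.card = p + 1) (hne : G.Nonempty) :
    ∃ (j : ℕ) (S : Fin (p + 1) → Finset V), (∀ i, (S i).card = 2 ^ j) ∧
      (∀ x ∈ Fintype.piFinset S, Function.Injective x) ∧ boxEdges S ⊆ G ∧
      y ≤ 24 * (1 + Real.log ((Fintype.card V : ℝ) ^ (p + 1) / G.card)) * 2 ^ j := by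
  set n := Fintype.card V with hn
  have hnpos : (0 : ℝ) < n := by exact_mod_cast Fintype.card_pos
  have hGpos : (0 : ℝ) < G.card := by exact_mod_cast hne.card_pos
  have hGle := card_le_card_pow hG
  set lam := Real.log ((n : ℝ) ^ (p + 1) / G.card) with hlam
  have hlam0 : 0 ≤ lam := Real.log_nonneg ((one_le_div hGpos).2 hGle)
  have henum : ∀ e ∈ G, ∃ x : Fin (p + 1) → V, Function.Injective x ∧ Finset.univ.image x = e := by
    intro e he
    have hinj : Function.Injective fun i =>
        (e.equivFin.symm (finCongr (hG e he).symm i) : V) :=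
      Subtype.val_injective.comp
        (e.equivFin.symm.injective.comp (finCongr (hG e he).symm).injective)
    refine ⟨_, hinj, Finset.eq_of_subset_of_card_le ?_ ?_⟩
    · exact Finset.image_subset_iff.2 fun i _ => Subtype.coe_prop _
    · rw [Finset.card_image_of_injective _ hinj, hG e he]
      simp
  -- If the target side is below `1`, a single edge serves as a box with `j = 0`. Otherwise the side
  -- is the largest power of two not exceeding the target.
  rcases lt_or_ge (y / (12 * (1 + lam))) 1 with hX | hX
  · obtain ⟨e, he⟩ := hne
    obtain ⟨x, hx, hxe⟩ := henum e he
    have hpi : Fintype.piFinset (fun i => ({x i} : Finset V)) = {x} := by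
      ext z
      simp [funext_iff]
    refine ⟨0, fun i => {x i}, by simp, ?_, ?_, ?_⟩
    · intro z hz
      rw [hpi, Finset.mem_singleton] at hz
      exact hz ▸ hx
    · rw [boxEdges, hpi, Finset.image_singleton, hxe, Finset.singleton_subset_iff]
      exact he
    · rw [div_lt_one (by positivity)] at hX
      rw [pow_zero, mul_one]
      nlinarith
  · set X := y / (12 * (1 + lam)) with hXdef
    set j := Nat.log 2 ⌊X⌋₊ with hj
    have hfl : ⌊X⌋₊ ≠ 0 := by
      have := Nat.le_floor (α := ℝ) (n := 1) (a := X) (by simpa using hX)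
      omega
    have hsX : ((2 : ℝ) ^ j) ≤ X := by
      have h1 : 2 ^ j ≤ ⌊X⌋₊ := Nat.pow_log_le_self 2 hfl
      have h2 : ((2 ^ j : ℕ) : ℝ) ≤ X := (Nat.cast_le.2 h1).trans (Nat.floor_le (by linarith))
      exact_mod_cast h2
    have hXs : X < 2 * 2 ^ j := by
      have h1 : ⌊X⌋₊ < 2 ^ (j + 1) := Nat.lt_pow_succ_log_self (by norm_num) _
      have h2 := (Nat.floor_lt (by linarith)).1 h1
      push_cast at h2
      linarith [pow_succ (2 : ℝ) j]
    classical
    set H : Finset (Fin (p + 1) → V) := Finset.univ.filter fun x =>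
      Function.Injective x ∧ Finset.univ.image x ∈ G with hH
    have hHcard : G.card ≤ H.card := by
      have hsub : G ⊆ H.image fun x => Finset.univ.image x := by
        intro e he
        obtain ⟨x, hx, hxe⟩ := henum e he
        exact Finset.mem_image.2 ⟨x, Finset.mem_filter.2 ⟨Finset.mem_univ _, hx, hxe ▸ he⟩, hxe⟩
      exact (Finset.card_le_card hsub).trans Finset.card_image_le
    have hN : (0 : ℝ) < (n : ℝ) ^ (p + 1) := by positivity
    have hlogn : 1 ≤ Real.log n := hyn ▸ one_le_pow₀ hy
    -- The density loss costs at most half of `log n` in the exponent, so the right side is at least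
    -- `√n`, whereas `4 * 2 ^ j ≤ log n / 3`.
    have hbig : 4 * (((2 ^ j : ℕ)) : ℝ) ≤
        n * ((G.card : ℝ) / (n : ℝ) ^ (p + 1) / 16) ^ ((2 * 2 ^ j) ^ p) := by
      have h16 : Real.log 16 ≤ 3 := by
        have : (16 : ℝ) = 2 ^ 4 := by norm_num
        rw [this, Real.log_pow]
        have := Real.log_two_lt_d9
        push_cast
        linarith
      have hlogd : Real.log ((G.card : ℝ) / (n : ℝ) ^ (p + 1) / 16) = -(lam + Real.log 16) := by
        rw [hlam, Real.log_div (by positivity) (by norm_num), Real.log_div hGpos.ne' hN.ne',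
          Real.log_div hN.ne' hGpos.ne']
        ring
      have hexp : ((2 * 2 ^ j : ℕ) : ℝ) ^ p * (lam + Real.log 16) ≤ Real.log n / 2 := by
        have h1 : ((2 * 2 ^ j : ℕ) : ℝ) ^ p ≤ (y / (6 * (1 + lam))) ^ p := by
          refine pow_le_pow_left₀ (by positivity) ?_ _
          push_cast
          have : y / (6 * (1 + lam)) = 2 * X := by
            rw [hXdef]; field_simp; norm_num
          linarith
        have h2 : (y / (6 * (1 + lam))) ^ p ≤ Real.log n / (6 * (1 + lam)) := by
          rw [div_pow, hyn]
          refine div_le_div_of_nonneg_left (by linarith) (by positivity) ?_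
          exact le_self_pow₀ (by linarith) (by omega)
        calc ((2 * 2 ^ j : ℕ) : ℝ) ^ p * (lam + Real.log 16)
            ≤ Real.log n / (6 * (1 + lam)) * (3 * (1 + lam)) := by
              refine mul_le_mul (h1.trans h2) (by linarith) ?_ (by positivity)
              have : 0 ≤ Real.log 16 := Real.log_nonneg (by norm_num)
              positivity
          _ = Real.log n / 2 := by field_simp; norm_num
      have hyle : y ≤ Real.log n := hyn ▸ le_self_pow₀ hy (by omega)
      have hXle : X ≤ Real.log n / 12 := by
        rw [hXdef]
        refine (div_le_div_of_nonneg_left (by linarith) (by norm_num)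
          (by linarith : (12 : ℝ) ≤ 12 * (1 + lam))).trans ?_
        linarith
      have hrhs : (n : ℝ) * ((G.card : ℝ) / (n : ℝ) ^ (p + 1) / 16) ^ ((2 * 2 ^ j) ^ p) =
          Real.exp (Real.log n - ((2 * 2 ^ j : ℕ) : ℝ) ^ p * (lam + Real.log 16)) := by
        rw [sub_eq_add_neg, Real.exp_add, Real.exp_log hnpos, ← mul_neg,
          ← hlogd, ← Nat.cast_pow (2 * 2 ^ j) p, Real.exp_nat_mul, Real.exp_log (by positivity)]
      rw [hrhs]
      calc 4 * (((2 ^ j : ℕ)) : ℝ) ≤ 4 * X := by push_cast; linarith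
        _ ≤ Real.log n / 2 + 1 := by linarith
        _ ≤ Real.exp (Real.log n / 2) := Real.add_one_le_exp _
        _ ≤ _ := Real.exp_le_exp.2 (by linarith)
    obtain ⟨S, hS, hSH⟩ := exists_box_subset (2 ^ j) Nat.one_le_two_pow p
      ((G.card : ℝ) / (n : ℝ) ^ (p + 1)) H (by positivity) ((div_le_one hN).2 hGle)
      (by rw [div_mul_cancel₀ _ hN.ne']; exact_mod_cast hHcard) hbig
    refine ⟨j, S, hS, fun x hx => (Finset.mem_filter.1 (hSH hx)).2.1, ?_, ?_⟩
    · intro e he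
      obtain ⟨x, hx, rfl⟩ := Finset.mem_image.1 he
      exact (Finset.mem_filter.1 (hSH hx)).2.2
    · have h1 : y = X * (12 * (1 + lam)) := by rw [hXdef]; field_simp
      rw [h1]
      nlinarith

/-- The concave function `u * (2 + log (N / u))` has derivative `1 + log (N / u)`, so it lies below
its tangent at `u + m`. It serves as the potential when a box of `m` edges is removed. -/
theorem mul_log_div_concave {N u m : ℝ} (hN : 0 < N) (hu : 0 ≤ u) (hm : 0 < m) :
    u * (2 + Real.log (N / u)) + m * (1 + Real.log (N / (u + m))) ≤
      (u + m) * (2 + Real.log (N / (u + m))) := by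
  rcases hu.eq_or_lt with rfl | hu
  · rw [zero_mul, zero_add, zero_add]
    nlinarith
  · have h1 : Real.log (N / u) = Real.log (N / (u + m)) + Real.log ((u + m) / u) := by
      rw [← Real.log_mul (by positivity) (by positivity)]
      congr 1
      field_simp
    have h2 := Real.log_le_sub_one_of_pos (show 0 < (u + m) / u by positivity)
    have h3 : u * ((u + m) / u - 1) = m := by field_simp; ring
    rw [h1]
    nlinarith

theorem mul_two_add_log_div_le {N e : ℝ} (he : 0 ≤ e) (heN : e ≤ N) :
    e * (2 + Real.log (N / e)) ≤ 3 * N := by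
  rcases he.eq_or_lt with rfl | he
  · rw [zero_mul]; linarith
  · have h2 := Real.log_le_sub_one_of_pos (div_pos (he.trans_le heN) he)
    have h3 : e * (N / e) = N := by field_simp
    nlinarith

/-- The exponent, per edge, in the bound for the number of colorings. -/
def blockConst (p k : ℕ) : ℕ := fewColorsConst p k * 2 ^ (p + 1) + fewColorsConst p k

/-- Strong induction on the number of edges, removing a large box. The cost per edge of the box is
of order `log n / 2 ^ j` plus a constant, and the lower bound on `2 ^ j` turns this into a multiple
of `1 + log (N / |G|)`, the decrement supplied by `mul_log_div_concave`. -/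
theorem card_colorings_le {V : Type*} [Fintype V] [Inhabited V] [DecidableEq V] {p k : ℕ}
    (hk : 3 ≤ k) (hpk : (p = 1 ∧ Even k) ∨ 2 ≤ p) {y : ℝ} (hy : 1 ≤ y)
    (hyn : y ^ p = Real.log (Fintype.card V)) (m : ℕ) : ∀ G : Finset (Finset V), G.card = m →
      (∀ e ∈ G, e.card = p + 1) →
      ((colorings k G).card : ℝ) ≤ Real.exp
        ((24 * fewColorsConst p k * (Real.log (Fintype.card V) / y) + blockConst p k) *
          (G.card * (2 + Real.log ((Fintype.card V : ℝ) ^ (p + 1) / G.card)))) := by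
  set n := Fintype.card V with hn
  set C := fewColorsConst p k with hC
  set K := blockConst p k with hK
  have hnpos : (0 : ℝ) < n := by exact_mod_cast Fintype.card_pos
  have hN : (0 : ℝ) < (n : ℝ) ^ (p + 1) := by positivity
  have hlogn : 1 ≤ Real.log n := hyn ▸ one_le_pow₀ hy
  induction m using Nat.strong_induction_on with
  | _ m ih =>
    intro G hGm hG
    rcases G.eq_empty_or_nonempty with rfl | hne
    · simp only [Finset.card_empty, Nat.cast_zero, zero_mul, mul_zero, Real.exp_zero]
      have : (colorings k (∅ : Finset (Finset V))).card ≤ 1 := by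
        refine Finset.card_le_one.2 fun c hc c' hc' => ?_
        ext e
        rw [(mem_colorings.1 hc).1 e (by simp), (mem_colorings.1 hc').1 e (by simp)]
      exact_mod_cast this
    obtain ⟨j, S, hS, hinj, hsub, hbound⟩ := exists_boxEdges_subset (by omega) hy hyn hG hne
    have hbox := card_boxEdges (pow_pos two_pos j) hS hinj
    have hboxpos : 0 < (boxEdges S).card := by rw [hbox]; positivity
    set B := boxEdges S with hB
    have hsd : (G \ B).card + B.card = G.card := Finset.card_sdiff_add_card_eq_card hsub
    have h1 := ih (G \ B).card (by omega) (G \ B) rfl fun e he => hG e (Finset.mem_sdiff.1 he).1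
    have h2 : ((colorings k B).card : ℝ) ≤ Real.exp
        ((24 * C * (Real.log n / y) + K) *
          (B.card * (1 + Real.log ((n : ℝ) ^ (p + 1) / G.card)))) := by
      have h5 : ((colorings k B).card : ℝ) ≤
          (n : ℝ) ^ (C * (2 ^ j) ^ p) * 2 ^ (K * (2 ^ j) ^ (p + 1)) := by
        exact_mod_cast card_colorings_boxEdges_le hk hpk hS hinj
      have hGpos : (0 : ℝ) < G.card := by exact_mod_cast hne.card_pos
      have hlam := Real.log_nonneg ((one_le_div hGpos).2 (card_le_card_pow hG))
      rw [← hn] at hlam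
      set lam := Real.log ((n : ℝ) ^ (p + 1) / G.card)
      have h6 : (n : ℝ) ^ (C * (2 ^ j) ^ p) ≤
          Real.exp (24 * C * (Real.log n / y) * ((2 ^ j) ^ (p + 1) * (1 + lam))) := by
        have e1 : (n : ℝ) ^ (C * (2 ^ j) ^ p) =
            Real.exp (((C * (2 ^ j) ^ p : ℕ) : ℝ) * Real.log n) := by
          rw [Real.exp_nat_mul, Real.exp_log hnpos]
        rw [e1]
        refine Real.exp_le_exp.2 ?_
        have e2 : 24 * C * (Real.log n / y) * ((2 ^ j) ^ (p + 1) * (1 + lam)) =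
            (C * (2 ^ j) ^ p * (Real.log n / y)) * (24 * (1 + lam) * 2 ^ j) := by ring
        have e3 : ((C * (2 ^ j) ^ p : ℕ) : ℝ) * Real.log n =
            (C * (2 ^ j) ^ p * (Real.log n / y)) * y := by
          push_cast
          field_simp
        rw [e2, e3]
        exact mul_le_mul_of_nonneg_left hbound (by positivity)
      have h7 : (2 : ℝ) ^ (K * (2 ^ j) ^ (p + 1)) ≤
          Real.exp (K * ((2 ^ j) ^ (p + 1) * (1 + lam))) := by
        have e1 : (2 : ℝ) ≤ Real.exp 1 := by linarith [Real.add_one_le_exp (1 : ℝ)]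
        calc (2 : ℝ) ^ (K * (2 ^ j) ^ (p + 1)) ≤ Real.exp 1 ^ (K * (2 ^ j) ^ (p + 1)) :=
              pow_le_pow_left₀ (by norm_num) e1 _
          _ = Real.exp (K * ((2 ^ j) ^ (p + 1) * 1)) := by
              rw [← Real.exp_nat_mul]; push_cast; simp
          _ ≤ _ := by
              refine Real.exp_le_exp.2 (mul_le_mul_of_nonneg_left
                (mul_le_mul_of_nonneg_left ?_ (by positivity)) (by positivity))
              linarith
      refine h5.trans ((mul_le_mul h6 h7 (by positivity) (Real.exp_pos _).le).trans ?_)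
      rw [← Real.exp_add, ← add_mul, hbox]
      push_cast
      exact le_rfl
    have h3 : ((colorings k G).card : ℝ) ≤ (colorings k B).card * (colorings k (G \ B)).card := by
      exact_mod_cast card_colorings_le_mul k hsub
    refine h3.trans ((mul_le_mul h2 h1 (Nat.cast_nonneg _) (Real.exp_pos _).le).trans ?_)
    rw [← Real.exp_add, ← mul_add]
    refine Real.exp_le_exp.2 (mul_le_mul_of_nonneg_left ?_ (by positivity))
    have h4 := mul_log_div_concave hN (Nat.cast_nonneg (G \ B).card)
      (by exact_mod_cast hboxpos : (0 : ℝ) < B.card)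
    rw [← Nat.cast_add, hsd] at h4
    linarith

/-! ### Summing over edge sets and fixing the constants -/

theorem card_edgeColoredGraph_le {V : Type*} [Fintype V] [Inhabited V] [DecidableEq V] (q k : ℕ) :
    Nat.card {G : EdgeColoredGraph q V // LooseCycleFree k G.extension} ≤
      ∑ E ∈ (Finset.powersetCard q (Finset.univ : Finset V)).powerset, (colorings k E).card := by
  rw [← Finset.card_sigma, ← Fintype.card_coe, ← Nat.card_eq_fintype_card]
  let φ : EdgeColoredGraph q V → (_ : Finset (Finset V)) × (Finset V → V) := fun G =>
    ⟨G.edges, fun e => if h : e ∈ G.edges then G.color ⟨e, h⟩ else default⟩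
  have hφ : ∀ G : EdgeColoredGraph q V, ∀ e (h : e ∈ G.edges), (φ G).2 e = G.color ⟨e, h⟩ :=
    fun G e h => dif_pos h
  have hmem : ∀ G : {G : EdgeColoredGraph q V // LooseCycleFree k G.extension}, φ G ∈
      (Finset.powersetCard q (Finset.univ : Finset V)).powerset.sigma fun E => colorings k E := by
    rintro ⟨G, hG⟩
    refine Finset.mem_sigma.2 ⟨?_, mem_colorings.2 ⟨fun e he => dif_neg he, fun e he => ?_, ?_⟩⟩
    · refine Finset.mem_powerset.2 fun e he => Finset.mem_powersetCard.2 ⟨Finset.subset_univ _, ?_⟩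
      exact G.sized he
    · rw [hφ G e he]
      exact G.color_notMem ⟨e, he⟩
    · refine hG.mono fun f hf => ?_
      obtain ⟨e, he, rfl⟩ := Finset.mem_image.1 hf
      rw [hφ G e he]
      exact Finset.mem_image.2 ⟨⟨e, he⟩, Finset.mem_attach _ _, rfl⟩
  refine Nat.card_le_card_of_injective (fun G => ⟨φ G, hmem G⟩) ?_
  rintro ⟨⟨E, hE, c, hc⟩, hG⟩ ⟨⟨E', hE', c', hc'⟩, hG'⟩ h
  obtain ⟨h1, h2⟩ := Sigma.mk.inj (Subtype.mk.inj h)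
  subst h1
  have hcc : c = c' := by
    ext ⟨e, he⟩
    have := congrFun (eq_of_heq h2) e
    simpa [he] using this
  subst hcc
  rfl

/-- The number of edge-colored graphs whose extension has no loose cycle, in exponential form. -/
theorem g_le_exp {p k n : ℕ} (hk : 3 ≤ k) (hpk : (p = 1 ∧ Even k) ∨ 2 ≤ p) (hn : 3 ≤ n) :
    (g (p + 2) n k : ℝ) ≤ Real.exp ((1 + 3 * (24 * fewColorsConst p k + blockConst p k)) *
      ((n : ℝ) ^ (p + 1) * Real.log n ^ (((p : ℝ) - 1) / p))) := by
  obtain ⟨m, rfl⟩ : ∃ m, n = m + 1 := ⟨n - 1, by omega⟩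
  set n := m + 1 with hndef
  have hp : 1 ≤ p := by omega
  have hp0 : (0 : ℝ) < p := by exact_mod_cast hp
  have hlogn : 1 ≤ Real.log n := by
    rw [Real.le_log_iff_exp_le (by positivity)]
    have : (3 : ℝ) ≤ n := by exact_mod_cast hn
    linarith [Real.exp_one_lt_d9]
  -- With `y ^ p = log n` the cost `log n / y` equals `(log n) ^ ((p - 1) / p)`, which is `1` when
  -- `p = 1`; hence no logarithm remains for `r = 3`.
  set y := Real.log n ^ ((1 : ℝ) / p) with hy
  have hy1 : 1 ≤ y := Real.one_le_rpow hlogn (by positivity)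
  have hyn : y ^ p = Real.log (Fintype.card (Fin n)) := by
    rw [hy, ← Real.rpow_natCast, ← Real.rpow_mul (by linarith), one_div_mul_cancel hp0.ne',
      Real.rpow_one, Fintype.card_fin]
  set T := Real.log n ^ (((p : ℝ) - 1) / p) with hT
  have hTeq : Real.log n / y = T := by
    have : ((p : ℝ) - 1) / p = 1 - 1 / p := by field_simp
    rw [hT, this, Real.rpow_sub (by linarith), Real.rpow_one]
  have hp1 : (1 : ℝ) ≤ p := by exact_mod_cast hp
  have hT1 : 1 ≤ T := Real.one_le_rpow hlogn (div_nonneg (by linarith) hp0.le)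
  set C : ℝ := (fewColorsConst p k : ℝ)
  set K : ℝ := (blockConst p k : ℝ)
  have hC0 : 0 ≤ C := Nat.cast_nonneg _
  have hK0 : 0 ≤ K := Nat.cast_nonneg _
  set N : ℝ := (n : ℝ) ^ (p + 1) with hN
  have hN0 : 0 < N := by positivity
  have hcol : ∀ E ∈ (Finset.powersetCard (p + 1) (Finset.univ : Finset (Fin n))).powerset,
      ((colorings k E).card : ℝ) ≤ Real.exp ((24 * C * T + K) * (3 * N)) := by
    intro E hE
    have hEs : ∀ e ∈ E, e.card = p + 1 := fun e he =>
      (Finset.mem_powersetCard.1 (Finset.mem_powerset.1 hE he)).2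
    refine (card_colorings_le hk hpk hy1 hyn _ E rfl hEs).trans (Real.exp_le_exp.2 ?_)
    have hcard := card_le_card_pow hEs
    rw [Fintype.card_fin] at hcard ⊢
    rw [hTeq]
    exact mul_le_mul_of_nonneg_left (mul_two_add_log_div_le (Nat.cast_nonneg _) hcard)
      (by positivity)
  have hpow : (2 : ℝ) ^ (n.choose (p + 1)) ≤ Real.exp N := by
    have e1 : (2 : ℝ) ≤ Real.exp 1 := by linarith [Real.add_one_le_exp (1 : ℝ)]
    calc (2 : ℝ) ^ (n.choose (p + 1)) ≤ Real.exp 1 ^ (n.choose (p + 1)) :=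
          pow_le_pow_left₀ (by norm_num) e1 _
      _ = Real.exp (n.choose (p + 1)) := by rw [← Real.exp_nat_mul, mul_one]
      _ ≤ Real.exp N := Real.exp_le_exp.2 (by rw [hN]; exact_mod_cast Nat.choose_le_pow n (p + 1))
  have hsum : (g (p + 2) n k : ℝ) ≤
      ∑ E ∈ (Finset.powersetCard (p + 1) (Finset.univ : Finset (Fin n))).powerset,
        ((colorings k E).card : ℝ) := by
    exact_mod_cast card_edgeColoredGraph_le (V := Fin n) (p + 1) k
  refine hsum.trans ((Finset.sum_le_card_nsmul _ _ _ hcol).trans ?_)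
  rw [Finset.card_powerset, Finset.card_powersetCard, Finset.card_univ, Fintype.card_fin,
    nsmul_eq_mul]
  push_cast
  refine (mul_le_mul_of_nonneg_right hpow (Real.exp_pos _).le).trans ?_
  rw [← Real.exp_add]
  refine Real.exp_le_exp.2 ?_
  have h1 : N ≤ N * T := le_mul_of_one_le_right hN0.le hT1
  have h2 : K * N ≤ K * (N * T) := mul_le_mul_of_nonneg_left h1 hK0
  nlinarith

theorem one_le_g {r n k : ℕ} (hk : 3 ≤ k) : 1 ≤ g r n k := by
  let G : EdgeColoredGraph (r - 1) (Fin n) :=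
    ⟨∅, by simp [Set.Sized], fun e => absurd e.2 (Finset.notMem_empty _),
      fun e => absurd e.2 (Finset.notMem_empty _)⟩
  have hG : LooseCycleFree k G.extension := by
    rintro ⟨e, v, he, -⟩
    have := he ⟨0, by omega⟩
    simp [EdgeColoredGraph.extension, G] at this
  have : Nonempty {G : EdgeColoredGraph (r - 1) (Fin n) // LooseCycleFree k G.extension} :=
    ⟨⟨G, hG⟩⟩
  exact Nat.card_pos

/-- The constant in the bound `g_le_two_rpow`. -/
noncomputable def mainConst (r k : ℕ) : ℝ :=
  (1 + 3 * (24 * fewColorsConst (r - 2) k + blockConst (r - 2) k)) / Real.log 2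

theorem mainConst_pos (r k : ℕ) : 0 < mainConst r k := by
  have := Real.log_pos one_lt_two
  unfold mainConst
  positivity

theorem g_le_two_rpow {r k n : ℕ} (hr : 3 ≤ r) (hk : 3 ≤ k) (hrk : (r = 3 ∧ Even k) ∨ 3 < r)
    (hn : 3 ≤ n) :
    (g r n k : ℝ) ≤ (2 : ℝ) ^ (mainConst r k * ((n : ℝ) ^ (r - 1) *
      Real.logb 2 n ^ (((r : ℝ) - 3) / ((r : ℝ) - 2)))) := by
  obtain ⟨p, rfl⟩ : ∃ p, r = p + 2 := ⟨r - 2, by omega⟩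
  refine (g_le_exp hk (hrk.imp (fun h => ⟨by omega, h.2⟩) fun h => by omega) hn).trans ?_
  have h2 := Real.log_pos one_lt_two
  have h2' : Real.log 2 ≤ 1 := by linarith [Real.log_two_lt_d9]
  have hlog : 0 ≤ Real.log n := Real.log_natCast_nonneg n
  have e1 : (((p + 2 : ℕ) : ℝ) - 3) / (((p + 2 : ℕ) : ℝ) - 2) = ((p : ℝ) - 1) / p := by
    push_cast
    congr 1 <;> ring
  have hp1 : (1 : ℝ) ≤ p := by exact_mod_cast (by omega : 1 ≤ p)
  rw [e1, Real.rpow_def_of_pos two_pos]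
  refine Real.exp_le_exp.2 ?_
  rw [mainConst, ← mul_assoc (Real.log 2), mul_div_cancel₀ _ h2.ne']
  refine mul_le_mul_of_nonneg_left (mul_le_mul_of_nonneg_left ?_ (by positivity)) (by positivity)
  refine Real.rpow_le_rpow hlog ?_ (div_nonneg (by linarith) (by linarith))
  rw [Real.logb, le_div_iff₀ h2]
  nlinarith

end LooseCycles

theorem mainTheorem6 :
    ∃ (c₁ : ℕ → ℝ) (c₂ : ℕ → ℕ → ℝ) (D : ℕ → ℝ),
      (∀ r, 0 < c₁ r) ∧ (∀ r k, 0 < c₂ r k) ∧ (∀ l, 0 < D l) ∧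
      ∀ r k : ℕ, 3 ≤ r → 3 ≤ k →
        (r = 3 → Even k → ∃ n₀ : ℕ, ∀ n : ℕ, n₀ ≤ n →
          (LooseCycles.g r n k : ℝ) ≤
            (2 : ℝ) ^ ((3 * (k : ℝ) * c₁ r + 4 * Real.logb 2 (D (k / 2))) * (n : ℝ) ^ 2)) ∧
        (3 < r → ∃ n₀ : ℕ, ∀ n : ℕ, n₀ ≤ n →
          (LooseCycles.g r n k : ℝ) ≤
            (2 : ℝ) ^ (2 * (c₂ r k + 2 * (r : ℝ)) * c₁ r * (n : ℝ) ^ (r - 1) *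
              Real.logb 2 (n : ℝ) ^ (((r : ℝ) - 3) / ((r : ℝ) - 2)))) ∧
        ((r = 3 ∧ Even k) ∨ 3 < r →
          (fun n : ℕ => Real.logb 2 (LooseCycles.g r n k : ℝ)) =O[atTop]
            (fun n : ℕ => (n : ℝ) ^ (r - 1) *
              Real.logb 2 (n : ℝ) ^ (((r : ℝ) - 3) / ((r : ℝ) - 2)))) := by
  -- The whole constant is placed in `c₂`, and for `r = 3` in `log D`. Since `k` is even, `2 * (k /
  -- 2) = k`, so `D` evaluated at `k / 2` recovers the constant for `k`.
  refine ⟨fun _ => 1, fun r k => LooseCycles.mainConst r k,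
    fun l => (2 : ℝ) ^ LooseCycles.mainConst 3 (2 * l), fun _ => one_pos,
    fun r k => LooseCycles.mainConst_pos r k, fun _ => by positivity, ?_⟩
  intro r k hr hk
  refine ⟨?_, ?_, ?_⟩
  · rintro rfl hk2
    refine ⟨3, fun n hn => (LooseCycles.g_le_two_rpow le_rfl hk (Or.inl ⟨rfl, hk2⟩) hn).trans ?_⟩
    refine Real.rpow_le_rpow_of_exponent_le one_le_two ?_
    simp only []
    rw [Nat.two_mul_div_two_of_even hk2, Real.logb_rpow two_pos (by norm_num)]
    have h1 := LooseCycles.mainConst_pos 3 k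
    have h2 : (0 : ℝ) ≤ (n : ℝ) ^ 2 := by positivity
    have h3 : (0 : ℝ) ≤ k := Nat.cast_nonneg _
    norm_num
    nlinarith [mul_nonneg h1.le h2, mul_nonneg h3 h2]
  · intro hr3
    refine ⟨3, fun n hn => (LooseCycles.g_le_two_rpow hr hk (Or.inr hr3) hn).trans ?_⟩
    refine Real.rpow_le_rpow_of_exponent_le one_le_two ?_
    rw [mul_assoc _ ((n : ℝ) ^ (r - 1))]
    have hlog : 0 ≤ Real.logb 2 n :=
      Real.logb_nonneg one_lt_two (by exact_mod_cast (by omega : 1 ≤ n))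
    refine mul_le_mul_of_nonneg_right ?_ (by positivity)
    have h1 := LooseCycles.mainConst_pos r k
    have h3 : (0 : ℝ) ≤ r := Nat.cast_nonneg _
    linarith
  · intro hrk
    refine IsBigO.of_bound (LooseCycles.mainConst r k) ?_
    filter_upwards [eventually_ge_atTop 3] with n hn
    have hg : (1 : ℝ) ≤ LooseCycles.g r n k := by exact_mod_cast LooseCycles.one_le_g hk
    have h1 := LooseCycles.g_le_two_rpow hr hk hrk hn
    rw [Real.norm_of_nonneg (Real.logb_nonneg one_lt_two hg)]
    refine ((Real.logb_le_iff_le_rpow one_lt_two (by linarith)).2 h1).trans ?_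
    exact mul_le_mul_of_nonneg_left (le_abs_self _) (LooseCycles.mainConst_pos r k).le
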